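/- **Games.** Let $N=[n]=\{1,\dots,n\}$. A simple game is a map $v:2^N\to\{0,1\}$ with $v(\emptyset)=0$, $v(N)=1$ and $v(S)\le v(T)$ for $S\subseteq T$. A coalition $S$ is winning if $v(S)=1$ and losing otherwise; $\mathcal W$, $\mathcal L$ and $\mathcal W^m$ denote the sets of winning, losing and (inclusion-)minimal winning coalitions. For voters $i,j$ write $i\succeq j$ if $v(S\cup\{j\})\le v(S\cup\{i\})$ for all $S\subseteq N\setminus\{i,j\}$. A simple game is complete if $i\succeq j$ or $j\succeq i$ for all $i,j$; it is weighted if there are $q>0$ and $w_1,\dots,w_n\ge 0$ with $v(S)=1\iff\sum_{i\in S}w_i\ge q$. Let $\mathcal S_n$, $\mathcal C_n$, $\mathcal T_n$ be the sets of simple, complete and weighted games on $n$ voters. **Shift-minimal coalitions.** Let the voters be linearly ordered, and let $v$ be a complete game in which $i\succeq j$ whenever $i$ comes before $j$ (for the natural order: $1\succeq 2\succeq\dots\succeq n$). A direct right-shift of $S$ is obtained by replacing some $i\in S$ by the next voter in the order, if that voter is not in $S$, or by deleting the last voter in the order from $S$; a right-shift of $S$ arises by a nonempty sequence of direct right-shifts.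 $\mathcal W^{sm}$ is the set of winning coalitions all of whose right-shifts are losing. **Power indices.** Let $\eta_i(v)=|\{S\subseteq N\setminus\{i\}:v(S)=0,\ v(S\cup\{i\})=1\}|$ and $$\mathrm{Bz}_i=\frac{\eta_i}{2^{n-1}},\quad \mathrm{ColPrev}_i=\frac{\eta_i}{|\mathcal W|},\quad \mathrm{ColIni}_i=\frac{\eta_i}{|\mathcal L|},\quad \mathrm{PGI}_i=|\{S\in\mathcal W^m:i\in S\}|,\quad \mathrm{DP}_i=\sum_{i\in S\in\mathcal W^m}\frac1{|S|},$$ $$\mathrm{Shift}_i=|\{S\in\mathcal W^{sm}:i\in S\}|,\qquad \mathrm{SDP}_i=\sum_{i\in S\in\mathcal W^{sm}}\frac1{|S|}.$$ The first five are defined for all simple games; $\mathrm{Shift}$ and $\mathrm{SDP}$ are defined, relative to a linear order of the voters, for the complete games in which $i\succeq j$ whenever $i$ comes before $j$. Let $\widehat P_i(v)=P_i(v)/\sum_{j}P_j(v)$ and $\|x\|_1=\sum_i|x_i|$. The functions $f_1^P,f_2^P$ are | $P$ | $f_1^P(k)$ | $f_2^P(k)$ | |---|---|---| | $\mathrm{Bz}$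 | $1$ | $k+1$ | | $\mathrm{ColPrev}$, $\mathrm{ColIni}$ | $2$ | $2k+1$ | | $\mathrm{PGI}$ | $k+1$ | $\frac{(k+1)(k+5)}4$ | | $\mathrm{DP}$ | $k+2$ | $\frac{k^2+6k+9}4$ | | $\mathrm{Shift}$ | $\frac{k+3}2$ | $\frac{k^2+3k+2}2$ | | $\mathrm{SDP}$ | $2k+1$ | $2k^2+k+1$ | **Corollary.** Let $1<k<n$ be integers, $P\in\{\mathrm{Bz},\mathrm{ColPrev},\mathrm{ColIni},\mathrm{PGI},\mathrm{DP},\mathrm{Shift},\mathrm{SDP}\}$, $\mathcal V\in\{\mathcal S,\mathcal C,\mathcal T\}$, and let $\sigma=(\sigma_1,\dots,\sigma_k,0,\dots,0)\in\mathbb R_{\ge0}^n$ with $\|\sigma\|_1=1$; put $\sigma'=(\sigma_1,\dots,\sigma_k)$. For $P\in\{\mathrm{Shift},\mathrm{SDP}\}$ fix any linear order of $[n]$ (for instance the natural one) and give $[k]$ the induced order. Then the minimum $$\Lambda=\min_{v'}\ \|\sigma'-\widehat P(v')\|_1,$$ over all games $v'\in\mathcal V_k$ for which $P$ is defined, exists,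 and every game $v\in\mathcal V_n$ for which $P$ is defined satisfies $$\|\widehat P(v)-\sigma\|_1\ \ge\ \min\left\{\frac{2}{f_2^P(k)},\ \frac{2\Lambda}{f_2^P(k)+k\,f_1^P(k)+3}\right\}.$$ For example, for $n\ge 3$ every simple game $v\in\mathcal S_n$ satisfies $\left\|\widehat{\mathrm{Bz}}(v)-\left(\tfrac34,\tfrac14,0,\dots,0\right)\right\|_1\ge\tfrac18$. -/

import Mathlib

/-! Simple, complete and weighted voting games, seven power indices, and their normalizations. -/

noncomputable section

namespace VotingGames

/-- A binary voting procedure on the voters `0, …, n - 1`: a map `2^N → {0, 1}`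
(`true` means that the coalition wins). -/
abbrev Game (n : ℕ) : Type := Finset (Fin n) → Bool

/-- A simple game: `v ∅ = 0`, `v N = 1`, and `v` is monotone. -/
def IsSimple {n : ℕ} (v : Game n) : Prop :=
  v ∅ = false ∧ v Finset.univ = true ∧
    ∀ S T : Finset (Fin n), S ⊆ T → v S = true → v T = true

/-- Voter `i` is at least as desirable as voter `j`. -/
def AtLeastAsDesirable {n : ℕ} (v : Game n) (i j : Fin n) : Prop :=
  (∀ S : Finset (Fin n), i ∉ S → j ∉ S → v (insert j S) = true → v (insert i S) = true) ∧
  (∀ S : Finset (Fin n), i ∉ S → j ∉ S → v (insert i S) = false → v (insert j S) = false)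

/-- A complete game: a simple game in which any two voters are comparable. -/
def IsComplete {n : ℕ} (v : Game n) : Prop :=
  IsSimple v ∧ ∀ i j : Fin n, AtLeastAsDesirable v i j ∨ AtLeastAsDesirable v j i

/-- A weighted game: a simple game of the form `[q; w₁, …, wₙ]` with `q > 0` and `w ≥ 0`. -/
def IsWeighted {n : ℕ} (v : Game n) : Prop :=
  IsSimple v ∧ ∃ (q : ℝ) (w : Fin n → ℝ), 0 < q ∧ (∀ i, 0 ≤ w i) ∧
    ∀ S : Finset (Fin n), v S = true ↔ q ≤ ∑ i ∈ S, w i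

/-- The three classes of games. -/
inductive GameClass where
  | simple
  | complete
  | weighted

/-- Membership of a game in one of the three classes. -/
def GameClass.Mem : GameClass → {n : ℕ} → Game n → Prop
  | .simple, _, v => IsSimple v
  | .complete, _, v => IsComplete v
  | .weighted, _, v => IsWeighted v

/-- The set of winning coalitions. -/
def winning {n : ℕ} (v : Game n) : Finset (Finset (Fin n)) :=
  Finset.univ.filter fun S => v S = true

/-- The set of losing coalitions. -/
def losing {n : ℕ} (v : Game n) : Finset (Finset (Fin n)) :=
  Finset.univ.filter fun S => v S = false

open Classical in
/-- The set of minimal winning coalitions. -/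
def minimalWinning {n : ℕ} (v : Game n) : Finset (Finset (Fin n)) :=
  Finset.univ.filter fun S => v S = true ∧ ∀ T : Finset (Fin n), T ⊂ S → v T = false

/-- The numbering of the voters by increasing rank lists them in the order of
non-increasing desirability. For `r i = i` this says `1 ⪰ 2 ⪰ ⋯ ⪰ n`. -/
def OrderedBy {n : ℕ} (r : Fin n → ℕ) (v : Game n) : Prop :=
  ∀ i j : Fin n, r i < r j → AtLeastAsDesirable v i j

/-- `T` is a direct right-shift of `S` (for the order of the voters by increasing rank `r`):
a member of `S` is replaced by the next voter in the order, who was not in `S`,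
or the last voter in the order is removed from `S`. -/
def DirectRightShift {n : ℕ} (r : Fin n → ℕ) (S T : Finset (Fin n)) : Prop :=
  ∃ i ∈ S,
    (∃ j, j ∉ S ∧ r i < r j ∧ (∀ l, ¬ (r i < r l ∧ r l < r j)) ∧ T = insert j (S.erase i)) ∨
    ((∀ l, r l ≤ r i) ∧ T = S.erase i)

/-- `T` is a right-shift of `S`: it arises by a (nonempty) sequence of direct right-shifts. -/
def RightShift {n : ℕ} (r : Fin n → ℕ) (S T : Finset (Fin n)) : Prop :=
  Relation.TransGen (DirectRightShift r) S T

open Classical in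
/-- The set of shift-minimal winning coalitions. -/
def shiftMinimalWinning {n : ℕ} (r : Fin n → ℕ) (v : Game n) : Finset (Finset (Fin n)) :=
  Finset.univ.filter fun S =>
    v S = true ∧ ∀ T : Finset (Fin n), RightShift r S T → v T = false

/-- The number of `i`-swings. -/
def swings {n : ℕ} (v : Game n) (i : Fin n) : ℕ :=
  (Finset.univ.filter fun S : Finset (Fin n) =>
    i ∉ S ∧ v S = false ∧ v (insert i S) = true).card

/-- The absolute Banzhaf index. -/
def banzhaf {n : ℕ} (v : Game n) (i : Fin n) : ℝ :=
  (swings v i : ℝ) / 2 ^ (n - 1)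

/-- The Coleman power to prevent action. -/
def colPrev {n : ℕ} (v : Game n) (i : Fin n) : ℝ :=
  (((winning v).filter fun S => i ∈ S ∧ v (S.erase i) = false).card : ℝ) / ((winning v).card : ℝ)

/-- The Coleman power to initiate action. -/
def colIni {n : ℕ} (v : Game n) (i : Fin n) : ℝ :=
  (((losing v).filter fun S => i ∉ S ∧ v (insert i S) = true).card : ℝ) / ((losing v).card : ℝ)

/-- The absolute Public Good index. -/
def publicGood {n : ℕ} (v : Game n) (i : Fin n) : ℝ :=
  (((minimalWinning v).filter fun S => i ∈ S).card : ℝ)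

/-- The absolute Deegan-Packel index. -/
def deeganPackel {n : ℕ} (v : Game n) (i : Fin n) : ℝ :=
  ∑ S ∈ (minimalWinning v).filter fun S => i ∈ S, 1 / (S.card : ℝ)

/-- The absolute Shift index. -/
def shiftIndex {n : ℕ} (r : Fin n → ℕ) (v : Game n) (i : Fin n) : ℝ :=
  (((shiftMinimalWinning r v).filter fun S => i ∈ S).card : ℝ)

/-- The absolute Shift-Deegan-Packel index. -/
def shiftDeeganPackel {n : ℕ} (r : Fin n → ℕ) (v : Game n) (i : Fin n) : ℝ :=
  ∑ S ∈ (shiftMinimalWinning r v).filter fun S => i ∈ S, 1 / (S.card : ℝ)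

/-- The seven power indices. -/
inductive PowerIndex where
  | Bz
  | ColPrev
  | ColIni
  | PGI
  | DP
  | Shift
  | SDP

/-- The value of a power index; only `Shift` and `SDP` use the numbering of the voters. -/
def PowerIndex.value : PowerIndex → {n : ℕ} → (Fin n → ℕ) → Game n → Fin n → ℝ
  | .Bz, _, _, v => banzhaf v
  | .ColPrev, _, _, v => colPrev v
  | .ColIni, _, _, v => colIni v
  | .PGI, _, _, v => publicGood v
  | .DP, _, _, v => deeganPackel v
  | .Shift, _, r, v => shiftIndex r v
  | .SDP, _, r, v => shiftDeeganPackel r v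

/-- The games on which a power index is defined: all simple games, except that `Shift` and `SDP`
need a complete game whose voters are numbered by non-increasing desirability. -/
def PowerIndex.Domain : PowerIndex → {n : ℕ} → (Fin n → ℕ) → Game n → Prop
  | .Shift, _, r, v => IsComplete v ∧ OrderedBy r v
  | .SDP, _, r, v => IsComplete v ∧ OrderedBy r v
  | _, _, _, v => IsSimple v

/-- Normalization to coordinate sum one. -/
def normalize {n : ℕ} (x : Fin n → ℝ) (i : Fin n) : ℝ := x i / ∑ j, x j

/-- The distance of two vectors in the `1`-norm. -/
def l1dist {n : ℕ} (x y : Fin n → ℝ) : ℝ := ∑ i, |x i - y i|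

/-- The first quality function. -/
def PowerIndex.f1 : PowerIndex → ℕ → ℝ
  | .Bz, _ => 1
  | .ColPrev, _ => 2
  | .ColIni, _ => 2
  | .PGI, k => (k : ℝ) + 1
  | .DP, k => (k : ℝ) + 2
  | .Shift, k => ((k : ℝ) + 3) / 2
  | .SDP, k => 2 * (k : ℝ) + 1

/-- The second quality function. -/
def PowerIndex.f2 : PowerIndex → ℕ → ℝ
  | .Bz, k => (k : ℝ) + 1
  | .ColPrev, k => 2 * (k : ℝ) + 1
  | .ColIni, k => 2 * (k : ℝ) + 1
  | .PGI, k => ((k : ℝ) + 1) * ((k : ℝ) + 5) / 4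
  | .DP, k => ((k : ℝ) ^ 2 + 6 * (k : ℝ) + 9) / 4
  | .Shift, k => ((k : ℝ) ^ 2 + 3 * (k : ℝ) + 2) / 2
  | .SDP, k => 2 * (k : ℝ) ^ 2 + (k : ℝ) + 1

/-- The vector of the first `k` coordinates. -/
def firstCoords {α : Type} {k n : ℕ} (h : k < n) (x : Fin n → α) : Fin k → α :=
  fun i => x (Fin.castLE h.le i)

end VotingGames

end

/-! Let `x` be the unnormalized index of `v`, `S` its total and `E` the part of it held by the
voters outside `[k]`. If the normalization of `x` is at distance `d` from `σ`, then `E / S ≤ d / 2`,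
because `σ` gives those voters nothing and this mass is also missing on `[k]`. So if `d` is small,
the outsiders have little power. The point is that in this case some game `v'` on `[k]` has nearly
proportional power: its index `y` satisfies `|x i - c * y i| ≤ E` for a scalar `c` and every `i` in
`[k]`. Normalizing both sides (`l1dist_normalize_le`) yields `Λ ≤ (k + 2) * d` whenever `d < 2 / (k
+ 1)`.

The game `v'` freezes the votes of the outsiders. For `Bz`, `ColPrev` and `ColIni`, all proportional
to the swing counts, the frozen votes come from a discrete isoperimetric argument (`exists_freeze`):
some frozen vote disagrees with the actual ones at most as often as the outsiders swing. For the
other indices all outsiders vote against. Minimal winning coalitions inside `[k]` are unchanged, so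
`PGI` and `DP` lose only coalitions containing an outsider. For `Shift` and `SDP` new shift-minimal
coalitions may appear; each is matched injectively with an old one of equal size that contains an
outsider (`exists_dominated_shiftMinimalWinning`, `shiftMinimalWinning_unique`).

The estimate is the same for all seven indices. The functions `f1` and `f2` enter only through `f1 ≥
1` and `f2 ≥ k + 1`. -/

namespace VotingGames

/-! ### Normalized vectors with little mass outside the first `k` coordinates. -/

/-- The voters of the large game that are not voters of the small one. -/
def otherVoters (k n : ℕ) : Finset (Fin n) := Finset.univ.filter fun j => k ≤ (j : ℕ)

lemma mem_otherVoters {k n : ℕ} (j : Fin n) : j ∈ otherVoters k n ↔ k ≤ (j : ℕ) := by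
  simp [otherVoters]

lemma castLE_notMem_otherVoters {k n : ℕ} (h : k ≤ n) (i : Fin k) :
    Fin.castLEEmb h i ∉ otherVoters k n := by
  simp [mem_otherVoters]

lemma sum_split_voters {k n : ℕ} (h : k ≤ n) (f : Fin n → ℝ) :
    ∑ j, f j = ∑ i : Fin k, f (Fin.castLE h i) + ∑ j ∈ otherVoters k n, f j := by
  rw [← Finset.sum_filter_not_add_sum_filter Finset.univ (fun j : Fin n => k ≤ (j : ℕ))]
  congr 1
  symm
  refine Finset.sum_bij (fun i _ => Fin.castLE h i) ?_ ?_ ?_ ?_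
  · intro i _; simp
  · intro a _ b _ hab; exact Fin.castLE_injective h hab
  · intro b hb
    simp only [Finset.mem_filter, Finset.mem_univ, true_and, not_le] at hb
    exact ⟨⟨b, hb⟩, Finset.mem_univ _, rfl⟩
  · intro i _; rfl

lemma l1dist_nonneg {n : ℕ} (x y : Fin n → ℝ) : 0 ≤ l1dist x y :=
  Finset.sum_nonneg fun _ _ => abs_nonneg _

lemma normalize_smul {n : ℕ} {a : ℝ} (ha : a ≠ 0) (x : Fin n → ℝ) :
    normalize (fun i => a * x i) = normalize x := by
  funext i
  simp only [normalize, ← Finset.mul_sum]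
  exact mul_div_mul_left _ _ ha

/-- If the first `k` entries of `x` are, up to a scalar, those of `y` within the mass that `x`
puts on the remaining entries, then a vector supported on the first `k` entries that is close to
the normalization of `x` is close to the normalization of `y`. -/
lemma l1dist_normalize_le {k n : ℕ} (h : k < n) {x σ : Fin n → ℝ} {y : Fin k → ℝ} {c : ℝ}
    (hx : ∀ j, 0 ≤ x j) (hxs : 0 < ∑ j, x j) (hy : ∀ i, 0 ≤ y i) (hc : 0 ≤ c)
    (hσ1 : ∑ j, σ j = 1) (hσ0 : ∀ j : Fin n, k ≤ (j : ℕ) → σ j = 0)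
    (hxy : ∀ i : Fin k, |x (Fin.castLE h.le i) - c * y i| ≤ ∑ j ∈ otherVoters k n, x j)
    (hd : l1dist (normalize x) σ < 2 / ((k : ℝ) + 1)) :
    (∃ i, y i ≠ 0) ∧
      l1dist (firstCoords h σ) (normalize y) ≤ ((k : ℝ) + 2) * l1dist (normalize x) σ := by
  set S := ∑ j, x j with hS
  set E := ∑ j ∈ otherVoters k n, x j with hE
  set d := l1dist (normalize x) σ with hdd
  have hE0 : 0 ≤ E := Finset.sum_nonneg fun j _ => hx j
  have hk : (0 : ℝ) < (k : ℝ) + 1 := by positivity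
  have hxsplit : S = ∑ i : Fin k, x (Fin.castLE h.le i) + E := sum_split_voters h.le x
  have hσsplit : ∑ i : Fin k, σ (Fin.castLE h.le i) = 1 := by
    have := sum_split_voters h.le σ
    rw [hσ1, Finset.sum_eq_zero fun j hj => hσ0 j ((mem_otherVoters j).1 hj)] at this
    linarith
  set D := ∑ i : Fin k, |normalize x (Fin.castLE h.le i) - σ (Fin.castLE h.le i)| with hD
  have hdsplit : d = D + E / S := by
    rw [hdd, l1dist, sum_split_voters h.le, hE, Finset.sum_div]
    congr 1
    refine Finset.sum_congr rfl fun j hj => ?_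
    rw [hσ0 j ((mem_otherVoters j).1 hj), sub_zero, abs_of_nonneg]
    · rfl
    · exact div_nonneg (hx j) hxs.le
  -- On `[k]` the vector `σ` has mass `1` and `normalize x` only `1 - E / S`. Together with
  -- `hdsplit` this gives `2 * (E / S) ≤ d`.
  have hDE : E / S ≤ D := by
    have h1 : ∑ i : Fin k, (σ (Fin.castLE h.le i) - normalize x (Fin.castLE h.le i)) = E / S := by
      rw [Finset.sum_sub_distrib, hσsplit]
      simp only [normalize, ← Finset.sum_div]
      rw [← hS, eq_div_iff hxs.ne', sub_mul, div_mul_cancel₀ _ hxs.ne']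
      linarith
    rw [← h1]
    refine Finset.sum_le_sum fun i _ => ?_
    rw [abs_sub_comm]
    exact le_abs_self _
  -- The threshold `2 / (k + 1)` is chosen for this inequality: it makes `Y ≥ S - (k + 1) * E`
  -- positive.
  have hε : ((k : ℝ) + 1) * E < S := by
    have : E / S < 1 / ((k : ℝ) + 1) := by
      have : 2 * (E / S) < 2 / ((k : ℝ) + 1) := by linarith
      rw [mul_comm] at this
      rw [show (2 : ℝ) / ((k : ℝ) + 1) = 1 / ((k : ℝ) + 1) * 2 by ring] at this
      linarith
    rw [div_lt_div_iff₀ hxs hk] at this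
    linarith
  set Y := c * ∑ i, y i with hY
  have hsum : ∑ i : Fin k, |x (Fin.castLE h.le i) - c * y i| ≤ k * E := by
    calc _ ≤ ∑ _i : Fin k, E := Finset.sum_le_sum fun i _ => hxy i
      _ = k * E := by simp
  have hYS : |(S - E) - Y| ≤ k * E := by
    refine le_trans ?_ hsum
    have : (S - E) - Y = ∑ i : Fin k, (x (Fin.castLE h.le i) - c * y i) := by
      rw [Finset.sum_sub_distrib, ← Finset.mul_sum, hxsplit]; ring
    rw [this]
    exact Finset.abs_sum_le_sum_abs _ _
  have hYpos : 0 < Y := by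
    have := (abs_le.1 hYS).2
    linarith
  have hys : ∑ i, y i ≠ 0 := by
    intro h0
    rw [hY, h0, mul_zero] at hYpos
    exact lt_irrefl _ hYpos
  refine ⟨?_, ?_⟩
  · by_contra! h0
    exact hys (Finset.sum_eq_zero fun i _ => h0 i)
  have hcp : c ≠ 0 := by
    rintro rfl
    simp [hY] at hYpos
  -- The intermediate value is `c * y i / S`: one error comes from the numerator, the other from
  -- replacing the total `S` by `Y`.
  have hterm : ∀ i : Fin k, |normalize x (Fin.castLE h.le i) - normalize y i| ≤
      |x (Fin.castLE h.le i) - c * y i| / S + c * y i * (((k : ℝ) + 1) * E) / (S * Y) := by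
    intro i
    have e1 : normalize x (Fin.castLE h.le i) - normalize y i =
        (x (Fin.castLE h.le i) - c * y i) / S + c * y i * (Y - S) / (S * Y) := by
      have : normalize y i = c * y i / Y := by
        rw [normalize, hY, mul_div_mul_left _ _ hcp]
      rw [this]
      simp only [normalize]
      rw [← hS]
      field_simp
      ring
    rw [e1]
    refine (abs_add_le _ _).trans (add_le_add ?_ ?_)
    · rw [abs_div, abs_of_pos hxs]
    · rw [abs_div, abs_mul, abs_of_pos (mul_pos hxs hYpos), abs_of_nonneg (mul_nonneg hc (hy i))]
      have h2 : |Y - S| ≤ ((k : ℝ) + 1) * E := by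
        rw [abs_le] at hYS ⊢
        constructor <;> linarith [hYS.1, hYS.2]
      have := mul_nonneg hc (hy i)
      gcongr
  have hdist : ∑ i : Fin k, |normalize x (Fin.castLE h.le i) - normalize y i| ≤
      (2 * (k : ℝ) + 1) * (E / S) := by
    calc _ ≤ ∑ i : Fin k, (|x (Fin.castLE h.le i) - c * y i| / S
          + c * y i * (((k : ℝ) + 1) * E) / (S * Y)) := Finset.sum_le_sum fun i _ => hterm i
      _ = (∑ i : Fin k, |x (Fin.castLE h.le i) - c * y i|) / S
          + Y * (((k : ℝ) + 1) * E) / (S * Y) := by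
        rw [Finset.sum_add_distrib, ← Finset.sum_div, ← Finset.sum_div, ← Finset.sum_mul,
          ← Finset.mul_sum]
      _ ≤ k * E / S + Y * (((k : ℝ) + 1) * E) / (S * Y) := by gcongr
      _ = (2 * (k : ℝ) + 1) * (E / S) := by field_simp; ring
  have htri : l1dist (firstCoords h σ) (normalize y) ≤
      D + ∑ i : Fin k, |normalize x (Fin.castLE h.le i) - normalize y i| := by
    rw [hD, ← Finset.sum_add_distrib]
    refine Finset.sum_le_sum fun i _ => ?_
    rw [abs_sub_comm (normalize x _) (σ _)]
    exact abs_sub_le _ _ _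
  have hES : 0 ≤ E / S := div_nonneg hE0 hxs.le
  have hk0 : (0 : ℝ) ≤ k := by positivity
  -- `D + (2k + 1) * (E / S) = d + 2k * (E / S) ≤ (k + 1) * d`, which is slightly better than
  -- needed.
  nlinarith [mul_nonneg hk0 (sub_nonneg.2 hDE), mul_nonneg hk0 hES]

/-! ### Restricting a game to the first `k` voters. -/

/-- The game on the voters `0, …, k - 1` in which the members of `T` always vote in favour. -/
def restrict {k n : ℕ} (e : Fin k ↪ Fin n) (T : Finset (Fin n)) (v : Game n) : Game k :=
  fun S => v (S.map e ∪ T)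

section restrict

variable {k n : ℕ} {e : Fin k ↪ Fin n} {T : Finset (Fin n)} {v : Game n}

/-- Monotonicity is inherited, so a restriction fails to be simple only by being constant; the two
coalitions exclude that. -/
lemma IsSimple.restrict (hv : IsSimple v) {S₁ S₂ : Finset (Fin k)}
    (h₁ : restrict e T v S₁ = true) (h₂ : restrict e T v S₂ = false) :
    IsSimple (restrict e T v) := by
  have hm : ∀ S U : Finset (Fin k), S ⊆ U →
      VotingGames.restrict e T v S = true → VotingGames.restrict e T v U = true :=
    fun S U h => hv.2.2 _ _ (Finset.union_subset_union_left (Finset.map_subset_map.2 h))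
  refine ⟨?_, hm _ _ (Finset.subset_univ _) h₁, hm⟩
  by_contra h
  rw [Bool.not_eq_false] at h
  rw [hm _ _ (Finset.empty_subset _) h] at h₂
  exact absurd h₂ (by simp)

lemma AtLeastAsDesirable.restrict (hT : ∀ i, e i ∉ T) {i j : Fin k}
    (h : AtLeastAsDesirable v (e i) (e j)) : AtLeastAsDesirable (restrict e T v) i j := by
  have hmem : ∀ (l : Fin k) (S : Finset (Fin k)), l ∉ S → e l ∉ S.map e ∪ T := by
    intro l S hl
    simp [hT l, hl]
  refine ⟨fun S hi hj => ?_, fun S hi hj => ?_⟩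
  · simpa [VotingGames.restrict, Finset.map_insert] using h.1 _ (hmem i S hi) (hmem j S hj)
  · simpa [VotingGames.restrict, Finset.map_insert] using h.2 _ (hmem i S hi) (hmem j S hj)

lemma OrderedBy.restrict (hT : ∀ i, e i ∉ T) {r : Fin n → ℕ} (h : OrderedBy r v) :
    OrderedBy (fun i => r (e i)) (restrict e T v) :=
  fun _ _ hij => (h _ _ hij).restrict hT

lemma GameClass.Mem.restrict (hT : ∀ i, e i ∉ T) {V : GameClass} (h : V.Mem v)
    (hs : IsSimple (restrict e T v)) : V.Mem (restrict e T v) := by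
  cases V
  · exact hs
  · exact ⟨hs, fun i j => (h.2 (e i) (e j)).imp (fun h => h.restrict hT) fun h => h.restrict hT⟩
  · obtain ⟨q, w, hq, hw, hv⟩ := h.2
    have key : ∀ S : Finset (Fin k), VotingGames.restrict e T v S = true ↔
        q - ∑ j ∈ T, w j ≤ ∑ i ∈ S, w (e i) := by
      intro S
      have hdisj : Disjoint (S.map e) T := by
        rw [Finset.disjoint_left]
        intro a ha
        obtain ⟨i, -, rfl⟩ := Finset.mem_map.1 ha
        exact hT i
      rw [VotingGames.restrict, hv, Finset.sum_union hdisj, Finset.sum_map, sub_le_iff_le_add]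
    refine ⟨hs, q - ∑ j ∈ T, w j, fun i => w (e i), ?_, fun i => hw _, key⟩
    -- A nonpositive remaining quota would let the empty coalition win.
    by_contra hneg
    have := (key ∅).2 (by simpa using hneg)
    rw [hs.1] at this
    exact absurd this (by simp)

end restrict

/-! ### Existence of the best approximation `Λ`. -/

/-- The unanimity game belongs to every class and to the domain of every power index. -/
lemma exists_unanimity_game {k : ℕ} (hk : 0 < k) (V : GameClass) (P : PowerIndex)
    (r : Fin k → ℕ) : ∃ v : Game k, V.Mem v ∧ P.Domain r v := by
  let v : Game k := fun S => decide (S = Finset.univ)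
  have hne : (∅ : Finset (Fin k)) ≠ Finset.univ := fun h =>
    absurd (h ▸ Finset.mem_univ (⟨0, hk⟩ : Fin k)) (by simp)
  have hs : IsSimple v := by
    refine ⟨by simpa [v] using hne, by simp [v], fun S T h hS => ?_⟩
    simp only [v, decide_eq_true_eq] at hS ⊢
    subst hS
    exact Finset.univ_subset_iff.1 h
  have hd : ∀ i j, AtLeastAsDesirable v i j := by
    intro i j
    have key : ∀ S : Finset (Fin k), i ∉ S → j ∉ S →
        insert j S = Finset.univ → insert i S = Finset.univ := by
      intro S hi _ h
      have : i ∈ insert j S := h ▸ Finset.mem_univ i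
      rcases Finset.mem_insert.1 this with rfl | h'
      · exact h
      · exact absurd h' hi
    refine ⟨fun S hi hj h => ?_, fun S hi hj h => ?_⟩
    · simp only [v, decide_eq_true_eq] at h ⊢
      exact key S hi hj h
    · simp only [v, decide_eq_false_iff_not] at h ⊢
      exact fun h' => h (key S hi hj h')
  have hc : IsComplete v := ⟨hs, fun i j => Or.inl (hd i j)⟩
  have hw : IsWeighted v := by
    refine ⟨hs, k, fun _ => 1, by exact_mod_cast hk, fun _ => zero_le_one, fun S => ?_⟩
    simp only [v, decide_eq_true_eq, Finset.sum_const, nsmul_eq_mul, mul_one, Nat.cast_le]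
    constructor
    · rintro rfl; simp
    · intro h
      refine Finset.eq_univ_of_card S (le_antisymm (Finset.card_le_univ S) ?_)
      simpa using h
  refine ⟨v, ?_, ?_⟩
  · cases V <;> assumption
  · cases P <;> first | exact hs | exact ⟨hc, fun i j _ => hd i j⟩

/-- Only finitely many values occur, so the best approximation exists. -/
lemma exists_isLeast_l1dist {k : ℕ} (hk : 0 < k) (V : GameClass) (P : PowerIndex)
    (r : Fin k → ℕ) (τ : Fin k → ℝ) :
    ∃ Λ : ℝ, IsLeast {d : ℝ | ∃ v' : Game k, V.Mem v' ∧ P.Domain r v' ∧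
      d = l1dist τ (normalize (P.value r v'))} Λ := by
  set A := {d : ℝ | ∃ v' : Game k, V.Mem v' ∧ P.Domain r v' ∧
      d = l1dist τ (normalize (P.value r v'))} with hA
  have hfin : A.Finite := by
    refine (Set.finite_range fun v' : Game k => l1dist τ (normalize (P.value r v'))).subset ?_
    rintro d ⟨v', -, -, rfl⟩
    exact ⟨v', rfl⟩
  have hne : A.Nonempty := by
    obtain ⟨v, h₁, h₂⟩ := exists_unanimity_game hk V P r
    exact ⟨_, v, h₁, h₂, rfl⟩
  obtain ⟨Λ, hΛ, hmin⟩ := hfin.exists_minimal hne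
  refine ⟨Λ, hΛ, fun d hd => ?_⟩
  rcases le_total Λ d with h | h
  · exact h
  · exact hmin hd h


/-! ### Freezing votes and counting swings. -/

/-- A family of Boolean functions on a cube can be frozen at a common point such that the total
number of disagreements is at most the total number of bichromatic edges. -/
lemma exists_freeze {α ι : Type*} [DecidableEq α] [Fintype ι] (M : Finset α) :
    ∀ F : ι → Finset α → Bool, ∃ T ⊆ M,
      ∑ s, ∑ U ∈ M.powerset, (if F s U ≠ F s T then 1 else 0) ≤
        ∑ s, ∑ j ∈ M, ∑ U ∈ M.powerset,
          (if j ∉ U ∧ F s U ≠ F s (insert j U) then 1 else 0) := by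
  induction M using Finset.induction_on with
  | empty => intro F; exact ⟨∅, subset_rfl, by simp⟩
  | insert a M ha ih =>
    intro F
    -- `F` and `G` are the two faces of the cube in direction `a`; `J` counts the bichromatic edges
    -- between them, `I` those inside a face.
    let G : ι → Finset α → Bool := fun s U => F s (insert a U)
    let I : (ι → Finset α → Bool) → ℕ := fun F => ∑ s, ∑ j ∈ M, ∑ U ∈ M.powerset,
          (if j ∉ U ∧ F s U ≠ F s (insert j U) then 1 else 0)
    let J : ℕ := ∑ s, ∑ U ∈ M.powerset, (if F s U ≠ G s U then 1 else 0)
    have hI : ∑ s, ∑ j ∈ insert a M, ∑ U ∈ (insert a M).powerset,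
          (if j ∉ U ∧ F s U ≠ F s (insert j U) then 1 else 0) = J + (I F + I G) := by
      simp only [I, J, ← Finset.sum_add_distrib]
      refine Finset.sum_congr rfl fun s _ => ?_
      rw [Finset.sum_insert ha]
      congr 1
      · rw [Finset.sum_powerset_insert ha]
        simp only [Finset.mem_insert_self, not_true_eq_false, false_and, if_false,
          Finset.sum_const_zero, add_zero]
        refine Finset.sum_congr rfl fun U hU => ?_
        have : a ∉ U := fun h => ha (Finset.mem_powerset.1 hU h)
        simp [this, G]
      · refine Finset.sum_congr rfl fun j hj => ?_
        rw [Finset.sum_powerset_insert ha, ← Finset.sum_add_distrib]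
        refine Finset.sum_congr rfl fun U hU => ?_
        have : j ≠ a := fun h => ha (h ▸ hj)
        simp [this, G, Finset.insert_comm j a]
    have hsplit : ∀ T, ∑ s, ∑ U ∈ (insert a M).powerset, (if F s U ≠ F s T then 1 else 0) =
        ∑ s, ∑ U ∈ M.powerset, (if F s U ≠ F s T then 1 else 0) +
          ∑ s, ∑ U ∈ M.powerset, (if G s U ≠ F s T then 1 else 0) := by
      intro T
      rw [← Finset.sum_add_distrib]
      exact Finset.sum_congr rfl fun s _ => Finset.sum_powerset_insert ha _
    rw [hI]
    -- The point `T` is taken in the face with fewer inner edges. The other face has at most `J`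
    -- more disagreements with it, so the total is at most `J + 2 * min (I F) (I G) ≤ J + I F + I
    -- G`.
    rcases le_total (I F) (I G) with h | h
    · obtain ⟨T, hT, hle⟩ := ih F
      refine ⟨T, hT.trans (Finset.subset_insert _ _), ?_⟩
      rw [hsplit]
      have hG : ∑ s, ∑ U ∈ M.powerset, (if G s U ≠ F s T then 1 else 0) ≤
          J + ∑ s, ∑ U ∈ M.powerset, (if F s U ≠ F s T then 1 else 0) := by
        simp only [J, ← Finset.sum_add_distrib]
        refine Finset.sum_le_sum fun s _ => Finset.sum_le_sum fun U _ => ?_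
        generalize F s U = b₁
        generalize G s U = b₂
        generalize F s T = b₃
        revert b₁ b₂ b₃
        decide
      change _ ≤ I F at hle
      omega
    · obtain ⟨T, hT, hle⟩ := ih G
      refine ⟨insert a T, Finset.insert_subset_insert _ hT, ?_⟩
      rw [hsplit]
      have hF : ∑ s, ∑ U ∈ M.powerset, (if F s U ≠ G s T then 1 else 0) ≤
          J + ∑ s, ∑ U ∈ M.powerset, (if G s U ≠ G s T then 1 else 0) := by
        simp only [J, ← Finset.sum_add_distrib]
        refine Finset.sum_le_sum fun s _ => Finset.sum_le_sum fun U _ => ?_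
        generalize F s U = b₁
        generalize G s U = b₂
        generalize G s T = b₃
        revert b₁ b₂ b₃
        decide
      change _ ≤ I G at hle
      change _ + ∑ s, ∑ U ∈ M.powerset, (if G s U ≠ G s T then 1 else 0) ≤ _
      change ∑ s, ∑ U ∈ M.powerset, (if F s U ≠ G s T then 1 else 0) + _ ≤ _
      omega

lemma sum_coalitions_split {k n : ℕ} (h : k ≤ n) (f : Finset (Fin n) → ℕ) :
    ∑ U, f U = ∑ S : Finset (Fin k), ∑ T ∈ (otherVoters k n).powerset,
      f (S.map (Fin.castLEEmb h) ∪ T) := by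
  rw [← Finset.sum_product']
  symm
  refine Finset.sum_nbij' (fun p => p.1.map (Fin.castLEEmb h) ∪ p.2)
    (fun U => (Finset.univ.filter fun i => Fin.castLEEmb h i ∈ U, U ∩ otherVoters k n))
    (fun _ _ => Finset.mem_univ _) ?_ ?_ ?_ (fun _ _ => rfl)
  · intro U _
    simp
  · rintro ⟨S, T⟩ hp
    simp only [Finset.mem_product, Finset.mem_univ, true_and, Finset.mem_powerset] at hp
    ext1
    · ext i
      have : Fin.castLEEmb h i ∉ T := fun hi => castLE_notMem_otherVoters h i (hp hi)
      simp only [Finset.mem_filter, Finset.mem_univ, true_and, Finset.mem_union, this, or_false]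
      exact Finset.mem_map' _
    · ext j
      simp only [Finset.mem_inter, Finset.mem_union]
      constructor
      · rintro ⟨hj | hj, hj'⟩
        · obtain ⟨i, -, rfl⟩ := Finset.mem_map.1 hj
          exact absurd hj' (castLE_notMem_otherVoters h i)
        · exact hj
      · exact fun hj => ⟨Or.inr hj, hp hj⟩
  · intro U _
    ext j
    simp only [Finset.mem_union, Finset.mem_map, Finset.mem_filter, Finset.mem_univ, true_and,
      Finset.mem_inter, mem_otherVoters]
    constructor
    · rintro (⟨i, hi, rfl⟩ | hj)
      · exact hi
      · exact hj.1
    · intro hj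
      rcases lt_or_ge (j : ℕ) k with hjk | hjk
      · exact Or.inl ⟨⟨j, hjk⟩, hj, rfl⟩
      · exact Or.inr ⟨hj, hjk⟩

lemma swings_eq_sum {n : ℕ} (v : Game n) (i : Fin n) :
    swings v i = ∑ S : Finset (Fin n),
      if i ∉ S ∧ v S = false ∧ v (insert i S) = true then 1 else 0 := by
  rw [swings, Finset.card_filter]

lemma sum_notMem_add_insert {n : ℕ} (i : Fin n) (f : Finset (Fin n) → ℕ) :
    ∑ S : Finset (Fin n), (if i ∉ S then f S + f (insert i S) else 0) = ∑ S, f S := by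
  have h : (Finset.univ : Finset (Finset (Fin n))) =
      (insert i (Finset.univ.erase i)).powerset := by
    rw [Finset.insert_erase (Finset.mem_univ i), Finset.powerset_univ]
  have hi : i ∉ (Finset.univ.erase i : Finset (Fin n)) := Finset.notMem_erase _ _
  rw [h, Finset.sum_powerset_insert hi, Finset.sum_powerset_insert hi,
    ← Finset.sum_add_distrib, ← Finset.sum_add_distrib]
  refine Finset.sum_congr rfl fun S hS => ?_
  have : i ∉ S := fun h => hi (Finset.mem_powerset.1 hS h)
  simp [this]

/-- Freezing the votes of the other voters suitably changes the number of swings of the remaining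
voters by at most the number of swings of the others. -/
lemma exists_restrict_swings {k n : ℕ} (h : k ≤ n) {v : Game n} (hv : IsSimple v) :
    ∃ T ⊆ otherVoters k n, ∀ i : Fin k,
      |(swings v (Fin.castLE h i) : ℝ) -
          2 ^ (otherVoters k n).card * (swings (restrict (Fin.castLEEmb h) T v) i : ℝ)| ≤
        ∑ j ∈ otherVoters k n, (swings v j : ℝ) := by
  set M := otherVoters k n with hM
  set e : Fin k ↪ Fin n := Fin.castLEEmb h with he
  let F : Finset (Fin k) → Finset (Fin n) → Bool := fun S U => v (S.map e ∪ U)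
  obtain ⟨T, hT, hle⟩ := exists_freeze M F
  refine ⟨T, hT, fun i => ?_⟩
  -- By monotonicity a bichromatic edge in direction `j` is exactly a swing of `j`.
  have hE : ∑ j ∈ M, swings v j = ∑ S, ∑ j ∈ M, ∑ U ∈ M.powerset,
      (if j ∉ U ∧ F S U ≠ F S (insert j U) then 1 else 0) := by
    rw [Finset.sum_comm]
    refine Finset.sum_congr rfl fun j hj => ?_
    rw [swings_eq_sum, sum_coalitions_split h]
    refine Finset.sum_congr rfl fun S _ => Finset.sum_congr rfl fun U _ => ?_
    have hjS : j ∉ S.map e := by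
      rintro hjS
      obtain ⟨i, -, rfl⟩ := Finset.mem_map.1 hjS
      exact castLE_notMem_otherVoters h i hj
    have hmono : v (S.map e ∪ U) = true → v (insert j (S.map e ∪ U)) = true :=
      hv.2.2 _ _ (Finset.subset_insert _ _)
    have hins : F S (insert j U) = v (insert j (S.map e ∪ U)) := by
      simp only [F, Finset.union_insert]
    rw [hins]
    change (if j ∉ S.map e ∪ U ∧ v (S.map e ∪ U) = false ∧ v (insert j (S.map e ∪ U)) = true
      then 1 else 0) = if j ∉ U ∧ v (S.map e ∪ U) ≠ v (insert j (S.map e ∪ U)) then 1 else 0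
    refine if_congr ?_ rfl rfl
    rw [Finset.mem_union, not_or]
    revert hmono
    cases v (S.map e ∪ U) <;> cases v (insert j (S.map e ∪ U)) <;> simp [hjS]
  have hx : swings v (Fin.castLE h i) = ∑ S : Finset (Fin k), ∑ U ∈ M.powerset,
      (if i ∉ S ∧ F S U = false ∧ F (insert i S) U = true then 1 else 0) := by
    rw [swings_eq_sum, sum_coalitions_split h]
    refine Finset.sum_congr rfl fun S _ => Finset.sum_congr rfl fun U hU => ?_
    have hiU : e i ∉ U := fun hi => castLE_notMem_otherVoters h i (Finset.mem_powerset.1 hU hi)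
    have hins : F (insert i S) U = v (insert (e i) (S.map e ∪ U)) := by
      simp only [F, Finset.map_insert, Finset.insert_union]
    rw [hins]
    change (if e i ∉ S.map e ∪ U ∧ v (S.map e ∪ U) = false ∧
      v (insert (e i) (S.map e ∪ U)) = true then 1 else 0) = _
    refine if_congr ?_ rfl rfl
    rw [Finset.mem_union, not_or, Finset.mem_map' e]
    simp only [hiU, not_false_eq_true, and_true, F]
  have hy : 2 ^ M.card * swings (restrict e T v) i = ∑ S : Finset (Fin k), ∑ U ∈ M.powerset,
      (if i ∉ S ∧ F S T = false ∧ F (insert i S) T = true then 1 else 0) := by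
    rw [swings_eq_sum, Finset.mul_sum]
    refine Finset.sum_congr rfl fun S _ => ?_
    rw [Finset.sum_const, Finset.card_powerset, smul_eq_mul]
    rfl
  set R := ∑ S, ∑ U ∈ M.powerset, (if F S U ≠ F S T then 1 else 0) with hR
  -- Each coalition lies in exactly one pair `S`, `insert i S`. A pair changes its swing status only
  -- if one of its ends disagrees with the frozen vote, so `R` bounds the change without a factor
  -- `2`.
  have hR' : R = ∑ S : Finset (Fin k), ∑ U ∈ M.powerset,
      (if i ∉ S then (if F S U ≠ F S T then 1 else 0) +
        (if F (insert i S) U ≠ F (insert i S) T then 1 else 0) else 0) := by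
    rw [hR, ← sum_notMem_add_insert i]
    refine Finset.sum_congr rfl fun S _ => ?_
    split_ifs <;> simp [Finset.sum_add_distrib]
  have hxy : swings v (Fin.castLE h i) ≤ 2 ^ M.card * swings (restrict e T v) i + R := by
    rw [hx, hy, hR']
    simp only [← Finset.sum_add_distrib]
    refine Finset.sum_le_sum fun S _ => Finset.sum_le_sum fun U _ => ?_
    by_cases hi : i ∈ S
    · simp [hi]
    · simp only [hi, not_false_eq_true, true_and, if_true]
      generalize F S U = b₁
      generalize F S T = b₂
      generalize F (insert i S) U = b₃
      generalize F (insert i S) T = b₄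
      revert b₁ b₂ b₃ b₄
      decide
  have hyx : 2 ^ M.card * swings (restrict e T v) i ≤ swings v (Fin.castLE h i) + R := by
    rw [hx, hy, hR']
    simp only [← Finset.sum_add_distrib]
    refine Finset.sum_le_sum fun S _ => Finset.sum_le_sum fun U _ => ?_
    by_cases hi : i ∈ S
    · simp [hi]
    · simp only [hi, not_false_eq_true, true_and, if_true]
      generalize F S U = b₁
      generalize F S T = b₂
      generalize F (insert i S) U = b₃
      generalize F (insert i S) T = b₄
      revert b₁ b₂ b₃ b₄
      decide
  have hRE : R ≤ ∑ j ∈ M, swings v j := hE ▸ hle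
  have h1 : (swings v (Fin.castLE h i) : ℝ) ≤
      2 ^ M.card * (swings (restrict e T v) i : ℝ) + R := by exact_mod_cast hxy
  have h2 : 2 ^ M.card * (swings (restrict e T v) i : ℝ) ≤
      (swings v (Fin.castLE h i) : ℝ) + R := by exact_mod_cast hyx
  have h3 : (R : ℝ) ≤ ∑ j ∈ M, (swings v j : ℝ) := by exact_mod_cast hRE
  rw [abs_le]
  constructor <;> linarith

/-! ### Banzhaf and Coleman indices as rescaled swing counts. -/

lemma colPrev_eq {n : ℕ} (v : Game n) (i : Fin n) :
    colPrev v i = (swings v i : ℝ) / ((winning v).card : ℝ) := by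
  rw [colPrev, swings]
  congr 2
  symm
  refine Finset.card_nbij' (fun S => insert i S) (fun S => S.erase i) ?_ ?_ ?_ ?_
  · intro S hS
    simp only [Finset.coe_filter, Finset.mem_univ, true_and, Set.mem_ofPred_eq] at hS
    simp [winning, hS.1, hS.2, Finset.erase_insert hS.1]
  · intro S hS
    simp only [winning, Finset.coe_filter, Finset.mem_filter, Finset.mem_univ, true_and,
      Set.mem_ofPred_eq] at hS
    simp [hS, Finset.insert_erase hS.2.1]
  · intro S hS
    simp only [Finset.coe_filter, Finset.mem_univ, true_and, Set.mem_ofPred_eq] at hS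
    exact Finset.erase_insert hS.1
  · intro S hS
    simp only [winning, Finset.coe_filter, Finset.mem_filter, Finset.mem_univ, true_and,
      Set.mem_ofPred_eq] at hS
    exact Finset.insert_erase hS.2.1

lemma colIni_eq {n : ℕ} (v : Game n) (i : Fin n) :
    colIni v i = (swings v i : ℝ) / ((losing v).card : ℝ) := by
  rw [colIni, swings, losing, Finset.filter_filter]
  congr 3
  ext S
  simp only [Finset.mem_filter, Finset.mem_univ, true_and]
  tauto

lemma normalize_div {n : ℕ} {a : ℝ} (ha : a ≠ 0) {x y : Fin n → ℝ} (h : ∀ i, y i = x i / a) :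
    normalize y = normalize x := by
  rw [← normalize_smul (inv_ne_zero ha) x]
  congr 1
  funext i
  rw [h, div_eq_inv_mul]

lemma normalize_banzhaf {n : ℕ} (v : Game n) :
    normalize (banzhaf v) = normalize fun i => (swings v i : ℝ) :=
  normalize_div (a := 2 ^ (n - 1)) (by positivity) fun _ => rfl

lemma normalize_colPrev {n : ℕ} {v : Game n} (hv : IsSimple v) :
    normalize (colPrev v) = normalize fun i => (swings v i : ℝ) := by
  refine normalize_div (a := ((winning v).card : ℝ)) ?_ (colPrev_eq v)
  have : Finset.univ ∈ winning v := by simp [winning, hv.2.1]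
  exact_mod_cast (Finset.card_pos.2 ⟨_, this⟩).ne'

lemma normalize_colIni {n : ℕ} {v : Game n} (hv : IsSimple v) :
    normalize (colIni v) = normalize fun i => (swings v i : ℝ) := by
  refine normalize_div (a := ((losing v).card : ℝ)) ?_ (colIni_eq v)
  have : ∅ ∈ losing v := by simp [losing, hv.1]
  exact_mod_cast (Finset.card_pos.2 ⟨_, this⟩).ne'

lemma exists_minimalWinning_subset {n : ℕ} {v : Game n} {S : Finset (Fin n)} (hS : v S = true) :
    ∃ C ∈ minimalWinning v, C ⊆ S := by
  induction S using Finset.strongInduction with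
  | H S ih =>
    by_cases h : ∃ T, T ⊂ S ∧ v T = true
    · obtain ⟨T, hTS, hT⟩ := h
      obtain ⟨C, hC, hCT⟩ := ih T hTS hT
      exact ⟨C, hC, hCT.trans hTS.subset⟩
    · push Not at h
      exact ⟨S, by simpa [minimalWinning, hS] using h, subset_rfl⟩

lemma sum_swings_pos {n : ℕ} {v : Game n} (hv : IsSimple v) :
    0 < ∑ i, (swings v i : ℝ) := by
  obtain ⟨C, hC, -⟩ := exists_minimalWinning_subset hv.2.1
  simp only [minimalWinning, Finset.mem_filter, Finset.mem_univ, true_and] at hC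
  obtain ⟨i, hi⟩ : C.Nonempty := by
    rw [Finset.nonempty_iff_ne_empty]
    rintro rfl
    rw [hv.1] at hC
    exact absurd hC.1 (by simp)
  refine Finset.sum_pos' (fun _ _ => Nat.cast_nonneg _) ⟨i, Finset.mem_univ _, ?_⟩
  rw [Nat.cast_pos, swings, Finset.card_pos]
  refine ⟨C.erase i, ?_⟩
  simp [Finset.insert_erase hi, hC.1, hC.2 _ (Finset.erase_ssubset hi)]


/-! ### The domination order and right-shifts. -/

/-- The number of members of `S` of rank less than `t`. -/
def countBelow {n : ℕ} (r : Fin n → ℕ) (S : Finset (Fin n)) (t : ℕ) : ℕ :=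
  (S.filter fun i => r i < t).card

/-- `S` dominates `T`: every initial segment of the order meets `S` at least as often as `T`. -/
def Dominates {n : ℕ} (r : Fin n → ℕ) (S T : Finset (Fin n)) : Prop :=
  ∀ t, countBelow r T t ≤ countBelow r S t

section order

variable {n : ℕ} {r : Fin n → ℕ}

lemma Dominates.refl (S : Finset (Fin n)) : Dominates r S S := fun _ => le_rfl

lemma Dominates.trans {S T U : Finset (Fin n)} (h₁ : Dominates r S T) (h₂ : Dominates r T U) :
    Dominates r S U := fun t => (h₂ t).trans (h₁ t)

lemma countBelow_succ (hr : Function.Injective r) (S : Finset (Fin n)) (i : Fin n) :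
    countBelow r S (r i + 1) = countBelow r S (r i) + if i ∈ S then 1 else 0 := by
  rw [countBelow, countBelow]
  split_ifs with h
  · rw [← Finset.card_insert_of_notMem (a := i) (by simp)]
    congr 1
    ext j
    simp only [Finset.mem_filter, Finset.mem_insert, Nat.lt_succ_iff_lt_or_eq, hr.eq_iff]
    constructor
    · rintro ⟨hj, hj' | rfl⟩
      · exact Or.inr ⟨hj, hj'⟩
      · exact Or.inl rfl
    · rintro (rfl | ⟨hj, hj'⟩)
      · exact ⟨h, Or.inr rfl⟩
      · exact ⟨hj, Or.inl hj'⟩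
  · rw [add_zero]
    congr 1
    ext j
    simp only [Finset.mem_filter, Nat.lt_succ_iff_lt_or_eq, hr.eq_iff]
    constructor
    · rintro ⟨hj, hj' | rfl⟩
      · exact ⟨hj, hj'⟩
      · exact absurd hj h
    · exact fun h => ⟨h.1, Or.inl h.2⟩

lemma countBelow_succ_of_ne (S : Finset (Fin n)) {t : ℕ} (ht : ∀ i ∈ S, r i ≠ t) :
    countBelow r S (t + 1) = countBelow r S t := by
  rw [countBelow, countBelow]
  congr 1
  refine Finset.filter_congr fun j hj => ?_
  have := ht j hj
  omega

lemma countBelow_mono (S : Finset (Fin n)) : Monotone (countBelow r S) := fun _ _ h =>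
  Finset.card_le_card (Finset.monotone_filter_right S fun _ _ hi => lt_of_lt_of_le hi h)

lemma countBelow_le_card (S : Finset (Fin n)) (t : ℕ) : countBelow r S t ≤ S.card :=
  Finset.card_le_card (Finset.filter_subset _ _)

lemma exists_countBelow_eq_card (r : Fin n → ℕ) :
    ∃ t, ∀ S : Finset (Fin n), countBelow r S t = S.card := by
  refine ⟨∑ i, r i + 1, fun S => ?_⟩
  rw [countBelow, Finset.filter_true_of_mem]
  intro i _
  exact Nat.lt_succ_of_le (Finset.single_le_sum (fun _ _ => Nat.zero_le _) (Finset.mem_univ i))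

lemma Dominates.card_le {S T : Finset (Fin n)} (h : Dominates r S T) : T.card ≤ S.card := by
  obtain ⟨t, ht⟩ := exists_countBelow_eq_card r
  simpa only [ht] using h t

lemma Dominates.antisymm (hr : Function.Injective r) {S T : Finset (Fin n)}
    (h₁ : Dominates r S T) (h₂ : Dominates r T S) : S = T := by
  ext i
  have h := countBelow_succ hr S i
  have h' := countBelow_succ hr T i
  have e : ∀ t, countBelow r S t = countBelow r T t := fun t => le_antisymm (h₂ t) (h₁ t)
  rw [e, e] at h
  by_cases hS : i ∈ S <;> by_cases hT : i ∈ T <;> simp [hS, hT] at h h' ⊢ <;> omega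

lemma countBelow_erase {S : Finset (Fin n)} {i : Fin n} (hi : i ∈ S) (t : ℕ) :
    countBelow r S t = countBelow r (S.erase i) t + if r i < t then 1 else 0 := by
  rw [countBelow, countBelow, Finset.filter_erase]
  split_ifs with h
  · rw [Finset.card_erase_add_one (by simp [hi, h])]
  · rw [Finset.erase_eq_of_notMem (by simp [h]), add_zero]

lemma countBelow_insert {S : Finset (Fin n)} {i : Fin n} (hi : i ∉ S) (t : ℕ) :
    countBelow r (insert i S) t = countBelow r S t + if r i < t then 1 else 0 := by
  rw [countBelow_erase (Finset.mem_insert_self i S), Finset.erase_insert hi]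

lemma dominates_erase {S : Finset (Fin n)} {i : Fin n} (hi : i ∈ S) :
    Dominates r S (S.erase i) := fun t => by
  rw [countBelow_erase hi]; exact Nat.le_add_right _ _

lemma DirectRightShift.dominates {S T : Finset (Fin n)} (h : DirectRightShift r S T) :
    Dominates r S T ∧ T ≠ S := by
  obtain ⟨i, hi, ⟨j, hj, hij, -, rfl⟩ | ⟨-, rfl⟩⟩ := h
  · have hj' : j ∉ S.erase i := fun h => hj (Finset.mem_of_mem_erase h)
    refine ⟨fun t => ?_, fun h => hj (h ▸ Finset.mem_insert_self _ _)⟩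
    rw [countBelow_erase hi, countBelow_insert hj']
    split_ifs <;> omega
  · exact ⟨dominates_erase hi, fun h => Finset.notMem_erase i S (h.symm ▸ hi)⟩

/-- A strictly dominated coalition is dominated by a direct right-shift. -/
lemma Dominates.exists_directRightShift (hr : Function.Injective r) {S T : Finset (Fin n)}
    (h : Dominates r S T) (hne : T ≠ S) :
    ∃ S', DirectRightShift r S S' ∧ Dominates r S' T := by
  classical
  let A : Finset (Fin n) :=
    S.filter fun a => countBelow r T (r a + 1) < countBelow r S (r a + 1)
  -- At the first `t + 1` where `S` is strictly ahead of `T`, the voter just counted belongs to `S`.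
  have hA : A.Nonempty := by
    have h0 : ∃ t, countBelow r T t < countBelow r S t := by
      by_contra! h0
      exact hne (Dominates.antisymm hr h0 h)
    have hlt := Nat.find_spec h0
    have hmin : ∀ s < Nat.find h0, countBelow r S s ≤ countBelow r T s := fun s hs =>
      not_lt.1 (Nat.find_min h0 hs)
    obtain ⟨t, ht⟩ : ∃ t, Nat.find h0 = t + 1 := by
      refine Nat.exists_eq_succ_of_ne_zero fun h00 => ?_
      rw [h00] at hlt
      simp [countBelow] at hlt
    rw [ht] at hlt
    have h1 := hmin t (by omega)
    have h2 := countBelow_mono (r := r) T (Nat.le_succ t)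
    by_contra hA
    have : ∀ i ∈ S, r i ≠ t := by
      rintro i hi rfl
      exact hA ⟨i, Finset.mem_filter.2 ⟨hi, hlt⟩⟩
    rw [countBelow_succ_of_ne S this] at hlt
    exact absurd (h2.trans_lt hlt) (not_lt.2 h1)
  obtain ⟨a, haA, hmax⟩ := Finset.exists_max_image A r hA
  obtain ⟨haS, hlt⟩ := Finset.mem_filter.1 haA
  by_cases hlast : ∀ l, r l ≤ r a
  · refine ⟨S.erase a, ⟨a, haS, Or.inr ⟨hlast, rfl⟩⟩, fun t => ?_⟩
    have h1 := countBelow_erase (r := r) haS t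
    have h2 := h t
    split_ifs at h1 with hat
    · have h3 : ∀ U : Finset (Fin n), countBelow r U t = countBelow r U (r a + 1) := by
        intro U
        rw [countBelow, countBelow]
        congr 1
        refine Finset.filter_congr fun j _ => ?_
        have := hlast j
        omega
      have := h3 S
      have := h3 T
      omega
    · omega
  · push Not at hlast
    have hB : (Finset.univ.filter fun l => r a < r l).Nonempty := by
      obtain ⟨l, hl⟩ := hlast
      exact ⟨l, by simpa using hl⟩
    obtain ⟨b, hb, hbmin⟩ := Finset.exists_min_image _ r hB
    simp only [Finset.mem_filter, Finset.mem_univ, true_and] at hb hbmin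
    -- Ranks may have gaps, but no voter ranks strictly between `a` and its successor `b`.
    have hflat : ∀ t, r a < t → t ≤ r b → ∀ U : Finset (Fin n),
        countBelow r U t = countBelow r U (r a + 1) := by
      intro t h1 h2 U
      rw [countBelow, countBelow]
      congr 1
      refine Finset.filter_congr fun j _ => ⟨fun h3 => ?_, fun h3 => by omega⟩
      by_contra h4
      have := hbmin j (by omega)
      omega
    -- If `b` were in `S`, the strict lead after `a` would persist after `b`, against the choice of
    -- `a` as the last such member.
    have hbS : b ∉ S := by
      intro hbS
      have hb1 := countBelow_succ hr S b
      have hb2 := countBelow_succ hr T b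
      rw [hflat (r b) hb le_rfl] at hb1 hb2
      rw [if_pos hbS] at hb1
      have : b ∈ A := by
        refine Finset.mem_filter.2 ⟨hbS, ?_⟩
        rw [hb1, hb2]
        split_ifs <;> omega
      have := hmax b this
      omega
    have hbS' : b ∉ S.erase a := fun h => hbS (Finset.mem_of_mem_erase h)
    refine ⟨insert b (S.erase a), ⟨a, haS, Or.inl ⟨b, hbS, hb, fun l hl => ?_, rfl⟩⟩,
      fun t => ?_⟩
    · have := hbmin l hl.1
      omega
    · have h1 := countBelow_erase (r := r) haS t
      have h2 := countBelow_insert (r := r) hbS' t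
      have h3 := h t
      by_cases h4 : r a < t
      · by_cases h5 : r b < t
        · rw [if_pos h4] at h1
          rw [if_pos h5] at h2
          omega
        · have := hflat t h4 (not_lt.1 h5) S
          have := hflat t h4 (not_lt.1 h5) T
          rw [if_pos h4] at h1
          rw [if_neg h5] at h2
          omega
      · rw [if_neg h4] at h1
        omega

/-- Strict domination decreases the sum of the counting function over the voters. -/
lemma Dominates.sum_lt (hr : Function.Injective r) {S T : Finset (Fin n)}
    (h : Dominates r S T) (hne : T ≠ S) :
    ∑ i, (countBelow r T (r i) + countBelow r T (r i + 1)) <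
      ∑ i, (countBelow r S (r i) + countBelow r S (r i + 1)) := by
  refine Finset.sum_lt_sum (fun i _ => add_le_add (h _) (h _)) ?_
  by_contra! h0
  refine hne ?_
  ext i
  have h1 := h0 i (Finset.mem_univ i)
  have h2 := h (r i)
  have h3 := h (r i + 1)
  have h4 := countBelow_succ hr S i
  have h5 := countBelow_succ hr T i
  by_cases hS : i ∈ S <;> by_cases hT : i ∈ T <;> simp [hS, hT] at h4 h5 ⊢ <;> omega

/-- Direct right-shifts depend on which voters are adjacent, hence on `n`. Domination only compares
counts, so it passes unchanged between the small and the large game (`dominates_map`). -/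
lemma rightShift_iff (hr : Function.Injective r) {S T : Finset (Fin n)} :
    RightShift r S T ↔ Dominates r S T ∧ T ≠ S := by
  constructor
  · intro h
    induction h with
    | single h => exact h.dominates
    | tail _ h ih =>
      refine ⟨ih.1.trans h.dominates.1, ?_⟩
      rintro rfl
      exact h.dominates.2 (Dominates.antisymm hr ih.1 h.dominates.1)
  · rintro ⟨h, hne⟩
    induction hm : ∑ i, (countBelow r S (r i) + countBelow r S (r i + 1)) using
      Nat.strong_induction_on generalizing S with
    | _ m ih =>
      obtain ⟨S', hS', h'⟩ := h.exists_directRightShift hr hne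
      by_cases he : T = S'
      · subst he
        exact Relation.TransGen.single hS'
      · subst hm
        exact Relation.TransGen.head hS'
          (ih _ (hS'.dominates.1.sum_lt hr hS'.dominates.2) h' he rfl)

lemma DirectRightShift.winning {v : Game n} (hv : IsSimple v) (ho : OrderedBy r v)
    {S T : Finset (Fin n)} (h : DirectRightShift r S T) (hT : v T = true) : v S = true := by
  obtain ⟨i, hi, ⟨j, hj, hij, -, rfl⟩ | ⟨-, rfl⟩⟩ := h
  · have := (ho i j hij).1 (S.erase i) (Finset.notMem_erase _ _)
      (fun h => hj (Finset.mem_of_mem_erase h)) hT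
    rwa [Finset.insert_erase hi] at this
  · exact hv.2.2 _ _ (Finset.erase_subset _ _) hT

lemma Dominates.winning {v : Game n} (hr : Function.Injective r) (hv : IsSimple v)
    (ho : OrderedBy r v) {S T : Finset (Fin n)} (h : Dominates r S T) (hT : v T = true) :
    v S = true := by
  by_cases hne : T = S
  · rwa [← hne]
  · have := (rightShift_iff hr).2 ⟨h, hne⟩
    clear h hne
    induction this using Relation.TransGen.head_induction_on with
    | single h => exact DirectRightShift.winning hv ho h hT
    | head h _ ih => exact DirectRightShift.winning hv ho h ih

lemma mem_shiftMinimalWinning (hr : Function.Injective r) {v : Game n} {S : Finset (Fin n)} :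
    S ∈ shiftMinimalWinning r v ↔
      v S = true ∧ ∀ T, Dominates r S T → v T = true → T = S := by
  simp only [shiftMinimalWinning, Finset.mem_filter, Finset.mem_univ, true_and, rightShift_iff hr]
  refine and_congr_right fun _ => forall_congr' fun T => ?_
  constructor
  · intro h h₁ h₂
    by_contra hne
    rw [h ⟨h₁, hne⟩] at h₂
    exact absurd h₂ (by simp)
  · rintro h ⟨h₁, hne⟩
    by_contra h₂
    exact hne (h h₁ (by simpa using h₂))

lemma exists_shiftMinimalWinning (hr : Function.Injective r) {v : Game n} {S : Finset (Fin n)}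
    (hS : v S = true) : ∃ C ∈ shiftMinimalWinning r v, Dominates r S C := by
  induction hm : ∑ i, (countBelow r S (r i) + countBelow r S (r i + 1)) using
    Nat.strong_induction_on generalizing S with
  | _ m ih =>
    by_cases h : ∃ T, Dominates r S T ∧ v T = true ∧ T ≠ S
    · obtain ⟨T, hST, hT, hne⟩ := h
      subst hm
      obtain ⟨C, hC, hTC⟩ := ih _ (hST.sum_lt hr hne) hT rfl
      exact ⟨C, hC, hST.trans hTC⟩
    · push Not at h
      exact ⟨S, (mem_shiftMinimalWinning hr).2 ⟨hS, h⟩, Dominates.refl S⟩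

/-- If `C` has fewer members than `S`, then `S` dominates `C` even without its last member. -/
lemma Dominates.exists_erase {S C : Finset (Fin n)} (h : Dominates r S C)
    (hlt : C.card < S.card) : ∃ i ∈ S, Dominates r (S.erase i) C := by
  have hS : S.Nonempty := Finset.card_pos.1 (by omega)
  obtain ⟨i, hi, hmax⟩ := Finset.exists_max_image S r hS
  refine ⟨i, hi, fun t => ?_⟩
  have h1 := countBelow_erase (r := r) hi t
  split_ifs at h1 with hit
  · have : countBelow r S t = S.card := by
      rw [countBelow, Finset.filter_true_of_mem]
      exact fun j hj => (hmax j hj).trans_lt hit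
    have := countBelow_le_card (r := r) C t
    omega
  · have := h t
    omega

/-- Two coalitions have a greatest common lower bound for domination. -/
lemma exists_meet (hr : Function.Injective r) (S₁ S₂ : Finset (Fin n)) :
    ∃ X, ∀ t, countBelow r X t = min (countBelow r S₁ t) (countBelow r S₂ t) := by
  let G : ℕ → ℕ := fun t => min (countBelow r S₁ t) (countBelow r S₂ t)
  refine ⟨Finset.univ.filter fun i => G (r i) < G (r i + 1), fun t => ?_⟩
  -- `G` starts at `0` and grows by at most `1` at each rank of a voter and nowhere else, so it is
  -- the counting function of the voters where it grows.
  change _ = G t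
  induction t with
  | zero => simp [countBelow, G]
  | succ t ih =>
    by_cases ht : ∃ i, r i = t
    · obtain ⟨i, rfl⟩ := ht
      rw [countBelow_succ hr, ih]
      have h1 := countBelow_succ hr S₁ i
      have h2 := countBelow_succ hr S₂ i
      simp only [Finset.mem_filter, Finset.mem_univ, true_and, G]
      split_ifs at h1 h2 ⊢ <;> omega
    · push Not at ht
      rw [countBelow_succ_of_ne _ fun i _ => ht i, ih]
      simp only [G]
      rw [countBelow_succ_of_ne S₁ fun i _ => ht i, countBelow_succ_of_ne S₂ fun i _ => ht i]

end order

/-! ### Shift-minimal coalitions when the other voters vote against. -/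

section embed

variable {k n : ℕ} {e : Fin k ↪ Fin n} {r : Fin n → ℕ} {v : Game n}

lemma countBelow_map (S : Finset (Fin k)) (t : ℕ) :
    countBelow r (S.map e) t = countBelow (fun i => r (e i)) S t := by
  rw [countBelow, countBelow, Finset.filter_map, Finset.card_map]
  rfl

lemma dominates_map {S T : Finset (Fin k)} :
    Dominates r (S.map e) (T.map e) ↔ Dominates (fun i => r (e i)) S T := by
  simp only [Dominates, countBelow_map]

lemma restrict_empty (S : Finset (Fin k)) : restrict e ∅ v S = v (S.map e) := by
  rw [restrict, Finset.union_empty]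

lemma shiftMinimalWinning_of_map (hr : Function.Injective r) {S : Finset (Fin k)}
    (h : S.map e ∈ shiftMinimalWinning r v) :
    S ∈ shiftMinimalWinning (fun i => r (e i)) (restrict e ∅ v) := by
  rw [mem_shiftMinimalWinning hr] at h
  have hr' : Function.Injective fun i => r (e i) := hr.comp e.injective
  rw [mem_shiftMinimalWinning hr']
  refine ⟨by rw [restrict_empty]; exact h.1, fun T hT hvT => ?_⟩
  rw [restrict_empty] at hvT
  exact Finset.map_injective e (h.2 _ (dominates_map.2 hT) hvT)

/-- A coalition that is shift-minimal winning only in the restricted game dominates a shift-minimal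
winning coalition of the same size with a member outside the restricted game. -/
lemma exists_dominated_shiftMinimalWinning (hr : Function.Injective r) {S : Finset (Fin k)}
    (h : S ∈ shiftMinimalWinning (fun i => r (e i)) (restrict e ∅ v))
    (hv : IsSimple v) (ho : OrderedBy r v)
    (hS : S.map e ∉ shiftMinimalWinning r v) :
    ∃ C ∈ shiftMinimalWinning r v, Dominates r (S.map e) C ∧ C.card = S.card ∧
      ∃ j ∈ C, ∀ i, e i ≠ j := by
  have hr' : Function.Injective fun i => r (e i) := hr.comp e.injective
  rw [mem_shiftMinimalWinning hr'] at h
  simp only [restrict_empty] at h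
  obtain ⟨C, hC, hSC⟩ := exists_shiftMinimalWinning hr h.1
  have hC' := (mem_shiftMinimalWinning hr).1 hC
  refine ⟨C, hC, hSC, ?_, ?_⟩
  · have hle := hSC.card_le
    rw [Finset.card_map] at hle
    -- If `C` were smaller, a member of `S` could be deleted while still dominating `C`, hence still
    -- winning, against the minimality of `S`.
    refine le_antisymm hle (not_lt.1 fun hlt => ?_)
    obtain ⟨j, hj, hd⟩ := hSC.exists_erase (by rwa [Finset.card_map])
    obtain ⟨i, hi, rfl⟩ := Finset.mem_map.1 hj
    rw [← Finset.map_erase] at hd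
    have := h.2 (S.erase i) (dominates_erase hi) (hd.winning hr hv ho hC'.1)
    exact Finset.notMem_erase i S (this.symm ▸ hi)
  -- A coalition `C` inside `[k]` would equal `S.map e` by minimality of `S`.
  · by_contra! hall
    have : ∃ C' : Finset (Fin k), C = C'.map e := by
      refine ⟨Finset.univ.filter fun i => e i ∈ C, ?_⟩
      ext j
      simp only [Finset.mem_map, Finset.mem_filter, Finset.mem_univ, true_and]
      constructor
      · intro hj
        obtain ⟨i, rfl⟩ := hall j hj
        exact ⟨i, hj, rfl⟩
      · rintro ⟨i, hi, rfl⟩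
        exact hi
    obtain ⟨C', rfl⟩ := this
    have := h.2 C' (dominates_map.1 hSC) hC'.1
    subst this
    exact hS hC

/-- The meet of `S₁` and `S₂` lives in the small game and still dominates `C`, so it wins;
minimality makes both equal to it. This makes the matching with old coalitions injective. -/
lemma shiftMinimalWinning_unique (hr : Function.Injective r) {S₁ S₂ : Finset (Fin k)}
    (h₁ : S₁ ∈ shiftMinimalWinning (fun i => r (e i)) (restrict e ∅ v))
    (h₂ : S₂ ∈ shiftMinimalWinning (fun i => r (e i)) (restrict e ∅ v))
    (hv : IsSimple v) (ho : OrderedBy r v) {C : Finset (Fin n)} (hC : v C = true)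
    (hd₁ : Dominates r (S₁.map e) C) (hd₂ : Dominates r (S₂.map e) C) : S₁ = S₂ := by
  have hr' : Function.Injective fun i => r (e i) := hr.comp e.injective
  rw [mem_shiftMinimalWinning hr'] at h₁ h₂
  obtain ⟨X, hX⟩ := exists_meet hr' S₁ S₂
  have hXC : Dominates r (X.map e) C := fun t => by
    rw [countBelow_map, hX]
    refine le_min ?_ ?_
    · rw [← countBelow_map]; exact hd₁ t
    · rw [← countBelow_map]; exact hd₂ t
  have hvX : restrict e ∅ v X = true := by
    rw [restrict_empty]
    exact hXC.winning hr hv ho hC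
  rw [← h₁.2 X (fun t => (hX t).trans_le (min_le_left _ _)) hvX,
    ← h₂.2 X (fun t => (hX t).trans_le (min_le_right _ _)) hvX]

end embed

/-! ### Comparing two families of coalitions. -/

/-- The sum of `φ |S|` over the members `S` of a family that contain a given voter. -/
def weightedCount {n : ℕ} (φ : ℕ → ℝ) (A : Finset (Finset (Fin n))) (i : Fin n) : ℝ :=
  ∑ S ∈ A with i ∈ S, φ S.card

lemma weightedCount_nonneg {n : ℕ} {φ : ℕ → ℝ} (hφ : ∀ m, 0 ≤ φ m) (A : Finset (Finset (Fin n)))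
    (i : Fin n) : 0 ≤ weightedCount φ A i :=
  Finset.sum_nonneg fun _ _ => hφ _

/-- Coalitions common to `A` and `B` cancel. What remains is the part of `A` meeting the other
voters and the part of `B` new to the small game, which `g` injects into the former with sizes kept.
Both contributions lie in `[0, D]`, so their difference is at most `D`, and each coalition in `D` is
charged to one of its outsiders. -/
lemma abs_weightedCount_sub_le {k n : ℕ} (h : k ≤ n) {φ : ℕ → ℝ} (hφ : ∀ m, 0 ≤ φ m)
    {A : Finset (Finset (Fin n))} {B : Finset (Finset (Fin k))}
    (hAB : ∀ S : Finset (Fin k), S.map (Fin.castLEEmb h) ∈ A → S ∈ B)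
    (g : Finset (Fin k) → Finset (Fin n))
    (hg : ∀ S ∈ B, S.map (Fin.castLEEmb h) ∉ A →
      g S ∈ A ∧ (g S).card = S.card ∧ ∃ j ∈ g S, j ∈ otherVoters k n)
    (hinj : ∀ S₁ ∈ B, S₁.map (Fin.castLEEmb h) ∉ A → ∀ S₂ ∈ B, S₂.map (Fin.castLEEmb h) ∉ A →
      g S₁ = g S₂ → S₁ = S₂) (i : Fin k) :
    |weightedCount φ A (Fin.castLE h i) - weightedCount φ B i| ≤
      ∑ j ∈ otherVoters k n, weightedCount φ A j := by
  classical
  set e := Fin.castLEEmb h with he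
  set M := otherVoters k n with hM
  set A' := A.filter fun S => ∃ j ∈ S, j ∈ M with hA'
  set B' := B.filter fun S => S.map e ∉ A with hB'
  set D := ∑ S ∈ A', φ S.card with hD
  have hDM : D ≤ ∑ j ∈ M, weightedCount φ A j := by
    simp only [weightedCount, Finset.sum_filter]
    rw [Finset.sum_comm, hD, hA', Finset.sum_filter]
    refine Finset.sum_le_sum fun S _ => ?_
    have hnn : ∀ j ∈ M, 0 ≤ if j ∈ S then φ S.card else 0 := by
      intro j _
      split_ifs
      · exact hφ _
      · exact le_rfl
    split_ifs with hS
    · obtain ⟨j, hjS, hjM⟩ := hS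
      refine le_trans ?_ (Finset.single_le_sum hnn hjM)
      rw [if_pos hjS]
    · exact Finset.sum_nonneg hnn
  have hBD : ∑ S ∈ B' with i ∈ S, φ S.card ≤ D := by
    have hmem : ∀ S ∈ B', S ∈ B ∧ S.map e ∉ A := fun S hS => Finset.mem_filter.1 hS
    calc ∑ S ∈ B' with i ∈ S, φ S.card ≤ ∑ S ∈ B', φ S.card :=
          Finset.sum_le_sum_of_subset_of_nonneg (Finset.filter_subset _ _) fun _ _ _ => hφ _
      _ = ∑ S ∈ B', φ (g S).card :=
          Finset.sum_congr rfl fun S hS => by rw [(hg S (hmem S hS).1 (hmem S hS).2).2.1]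
      _ = ∑ C ∈ B'.image g, φ C.card := by
          rw [Finset.sum_image]
          exact fun S₁ h₁ S₂ h₂ => hinj S₁ (hmem S₁ h₁).1 (hmem S₁ h₁).2 S₂ (hmem S₂ h₂).1
            (hmem S₂ h₂).2
      _ ≤ D := by
          refine Finset.sum_le_sum_of_subset_of_nonneg ?_ fun _ _ _ => hφ _
          intro C hC
          obtain ⟨S, hS, rfl⟩ := Finset.mem_image.1 hC
          obtain ⟨h1, -, h3⟩ := hg S (hmem S hS).1 (hmem S hS).2
          exact Finset.mem_filter.2 ⟨h1, h3⟩
  have hAD : ∑ S ∈ A' with e i ∈ S, φ S.card ≤ D :=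
    Finset.sum_le_sum_of_subset_of_nonneg (Finset.filter_subset _ _) fun _ _ _ => hφ _
  have hA0 : 0 ≤ ∑ S ∈ A' with e i ∈ S, φ S.card := Finset.sum_nonneg fun _ _ => hφ _
  have hB0 : 0 ≤ ∑ S ∈ B' with i ∈ S, φ S.card := Finset.sum_nonneg fun _ _ => hφ _
  have hcommon : ∑ S ∈ A with e i ∈ S ∧ ¬ ∃ j ∈ S, j ∈ M, φ S.card =
      ∑ S ∈ B with i ∈ S ∧ S.map e ∈ A, φ S.card := by
    symm
    refine Finset.sum_bij (fun S _ => S.map e) ?_ ?_ ?_ ?_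
    · intro S hS
      obtain ⟨-, hi, hSA⟩ := Finset.mem_filter.1 hS
      refine Finset.mem_filter.2 ⟨hSA, Finset.mem_map_of_mem e hi, ?_⟩
      rintro ⟨j, hj, hjM⟩
      obtain ⟨l, -, rfl⟩ := Finset.mem_map.1 hj
      exact castLE_notMem_otherVoters h l hjM
    · intro _ _ _ _ hab
      exact Finset.map_injective e hab
    · intro C hC
      obtain ⟨hCA, hi, hno⟩ := Finset.mem_filter.1 hC
      have hCmap : (Finset.univ.filter fun l => e l ∈ C).map e = C := by
        ext j
        simp only [Finset.mem_map, Finset.mem_filter, Finset.mem_univ, true_and]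
        constructor
        · rintro ⟨l, hl, rfl⟩
          exact hl
        · intro hj
          have hjk : (j : ℕ) < k := by
            by_contra hjk
            exact hno ⟨j, hj, (mem_otherVoters j).2 (not_lt.1 hjk)⟩
          exact ⟨⟨j, hjk⟩, hj, rfl⟩
      refine ⟨Finset.univ.filter fun l => e l ∈ C, ?_, hCmap⟩
      rw [Finset.mem_filter, hCmap]
      exact ⟨hAB _ (hCmap.symm ▸ hCA), by simpa using hi, hCA⟩
    · intro S _
      rw [Finset.card_map]
  have hAsplit : weightedCount φ A (Fin.castLE h i) =
      ∑ S ∈ A' with e i ∈ S, φ S.card +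
        ∑ S ∈ A with e i ∈ S ∧ ¬ ∃ j ∈ S, j ∈ M, φ S.card := by
    rw [hA', Finset.filter_comm, ← Finset.filter_filter, Finset.sum_filter_add_sum_filter_not]
    rfl
  have hBsplit : weightedCount φ B i =
      ∑ S ∈ B' with i ∈ S, φ S.card + ∑ S ∈ B with i ∈ S ∧ S.map e ∈ A, φ S.card := by
    rw [hB', Finset.filter_comm, ← Finset.filter_filter, Finset.sum_filter_not_add_sum_filter]
    rfl
  rw [hAsplit, hBsplit, hcommon, abs_le]
  constructor <;> linarith


lemma exists_mem_of_weightedCount_ne_zero {n : ℕ} {φ : ℕ → ℝ} {A : Finset (Finset (Fin n))}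
    {i : Fin n} (h : weightedCount φ A i ≠ 0) : ∃ S ∈ A, i ∈ S := by
  obtain ⟨S, hS, -⟩ := Finset.exists_ne_zero_of_sum_ne_zero h
  exact ⟨S, (Finset.mem_filter.1 hS).1, (Finset.mem_filter.1 hS).2⟩

lemma sum_weightedCount_pos {n : ℕ} {φ : ℕ → ℝ} (hφ : ∀ m, 0 ≤ φ m) (hφ' : ∀ m, 0 < m → 0 < φ m)
    {A : Finset (Finset (Fin n))} {C : Finset (Fin n)} (hC : C ∈ A) (hne : C.Nonempty) :
    0 < ∑ i, weightedCount φ A i := by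
  obtain ⟨i, hi⟩ := hne
  refine Finset.sum_pos' (fun i _ => weightedCount_nonneg hφ A i) ⟨i, Finset.mem_univ _, ?_⟩
  exact Finset.sum_pos' (fun _ _ => hφ _)
    ⟨C, Finset.mem_filter.2 ⟨hC, hi⟩, hφ' _ (Finset.card_pos.2 ⟨i, hi⟩)⟩

lemma IsSimple.nonempty {n : ℕ} {v : Game n} (hv : IsSimple v) {S : Finset (Fin n)}
    (hS : v S = true) : S.Nonempty := by
  rw [Finset.nonempty_iff_ne_empty]
  rintro rfl
  rw [hv.1] at hS
  exact absurd hS (by simp)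

/-- All subsets of a coalition of small-game voters are again such coalitions, so both games test
minimality on the same sets. -/
lemma minimalWinning_map_iff {k n : ℕ} (e : Fin k ↪ Fin n) (v : Game n) (S : Finset (Fin k)) :
    S.map e ∈ minimalWinning v ↔ S ∈ minimalWinning (restrict e ∅ v) := by
  simp only [minimalWinning, Finset.mem_filter, Finset.mem_univ, true_and, restrict_empty]
  refine and_congr_right fun _ => ⟨fun h T hT => h _ (Finset.map_ssubset_map.2 hT), ?_⟩
  intro h T hT
  obtain ⟨U, -, rfl⟩ := Finset.subset_map_iff.1 hT.subset
  exact h U (Finset.map_ssubset_map.1 hT)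

/-! ### The approximating game for each of the seven indices. -/

/-- The data that make a power index of a game on `n` voters comparable with that of a game on the
first `k` voters. -/
def HasApproximation (P : PowerIndex) {k n : ℕ} (h : k < n) (r : Fin n → ℕ) (v : Game n) : Prop :=
  ∃ (x : Fin n → ℝ) (y : Fin k → ℝ) (v' : Game k) (c : ℝ),
    normalize (P.value r v) = normalize x ∧ (∀ j, 0 ≤ x j) ∧ 0 < ∑ j, x j ∧ (∀ i, 0 ≤ y i) ∧
    0 ≤ c ∧
    (∀ i : Fin k, |x (Fin.castLE h.le i) - c * y i| ≤ ∑ j ∈ otherVoters k n, x j) ∧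
    ((∃ i, y i ≠ 0) → P.Domain (firstCoords h r) v' ∧
      (∀ V : GameClass, V.Mem v → V.Mem v') ∧
      normalize (P.value (firstCoords h r) v') = normalize y)

lemma hasApproximation_of_swings {P : PowerIndex} {k n : ℕ} (h : k < n) (r : Fin n → ℕ)
    {v : Game n} (hv : IsSimple v)
    (hP : ∀ {m : ℕ} (s : Fin m → ℕ) (w : Game m), IsSimple w →
      P.Domain s w ∧ normalize (P.value s w) = normalize fun i => (swings w i : ℝ)) :
    HasApproximation P h r v := by
  obtain ⟨T, hT, hle⟩ := exists_restrict_swings h.le hv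
  have hT' : ∀ i, Fin.castLEEmb h.le i ∉ T := fun i hi =>
    castLE_notMem_otherVoters h.le i (hT hi)
  refine ⟨fun j => swings v j, fun i => swings (restrict (Fin.castLEEmb h.le) T v) i,
    restrict (Fin.castLEEmb h.le) T v, 2 ^ (otherVoters k n).card, (hP r v hv).2,
    fun _ => Nat.cast_nonneg _, sum_swings_pos hv, fun _ => Nat.cast_nonneg _, by positivity,
    hle, ?_⟩
  -- The frozen game may be constant, but then it has no swings. A nonzero entry provides a swing,
  -- and with it a winning and a losing coalition.
  rintro ⟨i, hi⟩
  have hi' : swings (restrict (Fin.castLEEmb h.le) T v) i ≠ 0 := fun h0 => hi (by simp [h0])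
  obtain ⟨S, hS⟩ := Finset.card_pos.1 (Nat.pos_of_ne_zero hi')
  obtain ⟨-, -, h₁, h₂⟩ := Finset.mem_filter.1 hS
  have hs := hv.restrict h₂ h₁
  exact ⟨(hP _ _ hs).1, fun V hV => hV.restrict hT' hs, (hP _ _ hs).2⟩

lemma restrict_empty_isSimple {k n : ℕ} {e : Fin k ↪ Fin n} {v : Game n} (hv : IsSimple v)
    {S : Finset (Fin k)} (hS : restrict e ∅ v S = true) : IsSimple (restrict e ∅ v) := by
  refine hv.restrict hS (S₂ := ∅) ?_
  rw [restrict_empty, Finset.map_empty, hv.1]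

lemma hasApproximation_of_minimalWinning {P : PowerIndex} {φ : ℕ → ℝ} (hφ : ∀ m, 0 ≤ φ m)
    (hφ' : ∀ m, 0 < m → 0 < φ m) {k n : ℕ} (h : k < n) (r : Fin n → ℕ)
    {v : Game n} (hv : IsSimple v)
    (hP : ∀ {m : ℕ} (s : Fin m → ℕ) (w : Game m),
      (IsSimple w → P.Domain s w) ∧ P.value s w = weightedCount φ (minimalWinning w)) :
    HasApproximation P h r v := by
  set w := restrict (Fin.castLEEmb h.le) ∅ v with hw
  have hiff := minimalWinning_map_iff (Fin.castLEEmb h.le) v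
  refine ⟨weightedCount φ (minimalWinning v), weightedCount φ (minimalWinning w), w, 1,
    by rw [(hP r v).2], weightedCount_nonneg hφ _, ?_, weightedCount_nonneg hφ _, zero_le_one,
    fun i => ?_, ?_⟩
  · obtain ⟨C, hC, -⟩ := exists_minimalWinning_subset hv.2.1
    exact sum_weightedCount_pos hφ hφ' hC (hv.nonempty (Finset.mem_filter.1 hC).2.1)
  · rw [one_mul]
    -- No coalition is new here, so the matching is never used.
    exact abs_weightedCount_sub_le h.le hφ (fun S hS => (hiff S).1 hS) (fun _ => ∅)
      (fun S hS hS' => absurd ((hiff S).2 hS) hS')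
      (fun S hS hS' => absurd ((hiff S).2 hS) hS') i
  · rintro ⟨i, hi⟩
    obtain ⟨S, hS, -⟩ := exists_mem_of_weightedCount_ne_zero hi
    have hs : IsSimple w := restrict_empty_isSimple hv (Finset.mem_filter.1 hS).2.1
    exact ⟨(hP _ w).1 hs, fun V hV => hV.restrict (fun _ => Finset.notMem_empty _) hs,
      by rw [(hP _ w).2]⟩

lemma hasApproximation_of_shiftMinimalWinning {P : PowerIndex} {φ : ℕ → ℝ} (hφ : ∀ m, 0 ≤ φ m)
    (hφ' : ∀ m, 0 < m → 0 < φ m) {k n : ℕ} (h : k < n) {r : Fin n → ℕ}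
    (hr : Function.Injective r) {v : Game n} (hv : IsComplete v) (ho : OrderedBy r v)
    (hP : ∀ {m : ℕ} (s : Fin m → ℕ) (w : Game m),
      (IsComplete w → OrderedBy s w → P.Domain s w) ∧
        P.value s w = weightedCount φ (shiftMinimalWinning s w)) :
    HasApproximation P h r v := by
  set e := Fin.castLEEmb h.le with he
  set w := restrict e ∅ v with hw
  have hrk : firstCoords h r = fun i => r (e i) := rfl
  have hdom : ∀ S : Finset (Fin k), ∃ C : Finset (Fin n),
      S ∈ shiftMinimalWinning (fun i => r (e i)) w → S.map e ∉ shiftMinimalWinning r v →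
        C ∈ shiftMinimalWinning r v ∧ Dominates r (S.map e) C ∧ C.card = S.card ∧
          ∃ j ∈ C, ∀ i, e i ≠ j := by
    intro S
    by_cases hS : S ∈ shiftMinimalWinning (fun i => r (e i)) w ∧
        S.map e ∉ shiftMinimalWinning r v
    · obtain ⟨C, hC⟩ := exists_dominated_shiftMinimalWinning hr hS.1 hv.1 ho hS.2
      exact ⟨C, fun _ _ => hC⟩
    · exact ⟨∅, fun h₁ h₂ => absurd ⟨h₁, h₂⟩ hS⟩
  choose g hg using hdom
  have hvg : ∀ {C}, C ∈ shiftMinimalWinning r v → v C = true := fun hC =>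
    ((mem_shiftMinimalWinning hr).1 hC).1
  refine ⟨weightedCount φ (shiftMinimalWinning r v),
    weightedCount φ (shiftMinimalWinning (fun i => r (e i)) w), w, 1,
    by rw [(hP r v).2], weightedCount_nonneg hφ _, ?_, weightedCount_nonneg hφ _, zero_le_one,
    fun i => ?_, ?_⟩
  · obtain ⟨C, hC, -⟩ := exists_shiftMinimalWinning hr hv.1.2.1
    exact sum_weightedCount_pos hφ hφ' hC (hv.1.nonempty (hvg hC))
  · rw [one_mul]
    refine abs_weightedCount_sub_le h.le hφ (fun S hS => shiftMinimalWinning_of_map hr hS) g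
      (fun S hS hS' => ?_) (fun S₁ h₁ h₁' S₂ h₂ h₂' hgg => ?_) i
    · obtain ⟨hC, -, hcard, j, hj, hne⟩ := hg S hS hS'
      refine ⟨hC, hcard, j, hj, (mem_otherVoters j).2 (not_lt.1 fun hjk => ?_)⟩
      exact hne ⟨j, hjk⟩ rfl
    · obtain ⟨hC, hd₁, -⟩ := hg S₁ h₁ h₁'
      obtain ⟨-, hd₂, -⟩ := hg S₂ h₂ h₂'
      exact shiftMinimalWinning_unique hr h₁ h₂ hv.1 ho (hvg hC) hd₁ (hgg ▸ hd₂)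
  · rintro ⟨i, hi⟩
    obtain ⟨S, hS, -⟩ := exists_mem_of_weightedCount_ne_zero hi
    have hs : IsSimple w := restrict_empty_isSimple hv.1
      ((mem_shiftMinimalWinning (hr.comp e.injective)).1 hS).1
    have hnot : ∀ i, e i ∉ (∅ : Finset (Fin n)) := fun _ => Finset.notMem_empty _
    have hc : IsComplete w := GameClass.Mem.restrict (V := .complete) hnot hv hs
    exact ⟨(hP _ w).1 hc (ho.restrict hnot), fun V hV => hV.restrict hnot hs,
      by rw [(hP _ w).2, hrk]⟩

lemma hasApproximation (P : PowerIndex) {k n : ℕ} (h : k < n) {r : Fin n → ℕ}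
    (hr : Function.Injective r) {v : Game n} (hv : P.Domain r v) : HasApproximation P h r v := by
  have hone : (∀ m : ℕ, (0 : ℝ) ≤ (fun _ : ℕ => (1 : ℝ)) m) ∧
      ∀ m : ℕ, 0 < m → (0 : ℝ) < (fun _ : ℕ => (1 : ℝ)) m :=
    ⟨fun _ => zero_le_one, fun _ _ => zero_lt_one⟩
  have hinv : (∀ m : ℕ, (0 : ℝ) ≤ (fun m : ℕ => 1 / (m : ℝ)) m) ∧
      ∀ m : ℕ, 0 < m → (0 : ℝ) < (fun m : ℕ => 1 / (m : ℝ)) m :=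
    ⟨fun m => by positivity, fun m hm => by positivity⟩
  have hcard : ∀ {m : ℕ} (A : Finset (Finset (Fin m))),
      (fun i => ((A.filter fun S => i ∈ S).card : ℝ)) = weightedCount (fun _ => 1) A := by
    intro m A
    funext i
    simp [weightedCount]
  cases P with
  | Bz => exact hasApproximation_of_swings h r hv fun _ w hw => ⟨hw, normalize_banzhaf w⟩
  | ColPrev => exact hasApproximation_of_swings h r hv fun _ _ hw => ⟨hw, normalize_colPrev hw⟩
  | ColIni => exact hasApproximation_of_swings h r hv fun _ _ hw => ⟨hw, normalize_colIni hw⟩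
  | PGI =>
    exact hasApproximation_of_minimalWinning hone.1 hone.2 h r hv
      fun _ w => ⟨id, hcard (minimalWinning w)⟩
  | DP => exact hasApproximation_of_minimalWinning hinv.1 hinv.2 h r hv fun _ _ => ⟨id, rfl⟩
  | Shift =>
    exact hasApproximation_of_shiftMinimalWinning hone.1 hone.2 h hr hv.1 hv.2
      fun s w => ⟨fun h₁ h₂ => ⟨h₁, h₂⟩, hcard (shiftMinimalWinning s w)⟩
  | SDP =>
    exact hasApproximation_of_shiftMinimalWinning hinv.1 hinv.2 h hr hv.1 hv.2
      fun _ _ => ⟨fun h₁ h₂ => ⟨h₁, h₂⟩, rfl⟩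

/-! ### The quality functions and the Banzhaf example. -/

lemma one_le_f1 (P : PowerIndex) {k : ℕ} (hk : 1 < k) : 1 ≤ P.f1 k := by
  have : (1 : ℝ) < k := by exact_mod_cast hk
  cases P <;> simp only [PowerIndex.f1] <;> linarith

lemma add_one_le_f2 (P : PowerIndex) {k : ℕ} (hk : 1 < k) : (k : ℝ) + 1 ≤ P.f2 k := by
  have : (1 : ℝ) < k := by exact_mod_cast hk
  cases P <;> simp only [PowerIndex.f2] <;> nlinarith

lemma half_le_l1dist_banzhaf_two {v : Game 2} (hv : IsSimple v) (τ : Fin 2 → ℝ)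
    (h₀ : τ 0 = 3 / 4) (h₁ : τ 1 = 1 / 4) : 1 / 2 ≤ l1dist τ (normalize (banzhaf v)) := by
  have hS : (Finset.univ : Finset (Finset (Fin 2))) = {∅, {0}, {1}, {0, 1}} := by decide
  have h01 : v {0, 1} = true := hv.2.1
  have h10 : v {1, 0} = true := by rw [Finset.pair_comm]; exact h01
  have e : v ∅ = false := hv.1
  have key : ∀ i, swings v i = ∑ S ∈ ({∅, {0}, {1}, {0, 1}} : Finset (Finset (Fin 2))),
      if i ∉ S ∧ v S = false ∧ v (insert i S) = true then 1 else 0 := by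
    intro i
    rw [swings_eq_sum, hS]
  have k0 : swings v 0 = (if v {0} = true then 1 else 0) + if v {1} = false then 1 else 0 := by
    rw [key, Finset.sum_insert (by decide), Finset.sum_insert (by decide),
      Finset.sum_insert (by decide), Finset.sum_singleton]
    simp [e, h01]
  have k1 : swings v 1 = (if v {1} = true then 1 else 0) + if v {0} = false then 1 else 0 := by
    rw [key, Finset.sum_insert (by decide), Finset.sum_insert (by decide),
      Finset.sum_insert (by decide), Finset.sum_singleton]
    simp [e, h10, add_comm]
  rw [normalize_banzhaf, l1dist, Fin.sum_univ_two, normalize, normalize, Fin.sum_univ_two,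
    k0, k1, h₀, h₁]
  cases v {0} <;> cases v {1} <;> norm_num [abs_of_nonneg, abs_of_nonpos]

end VotingGames

theorem mainTheorem2 :
    (∀ (P : VotingGames.PowerIndex) (V : VotingGames.GameClass)
        (n k : ℕ) (_ : 1 < k) (hkn : k < n)
        (r : Fin n → ℕ) (_ : Function.Injective r)
        (σ : Fin n → ℝ) (_ : ∀ i, 0 ≤ σ i) (_ : ∑ i, |σ i| = 1)
        (_ : ∀ i : Fin n, k ≤ (i : ℕ) → σ i = 0),
      ∃ Λ : ℝ,
        IsLeast
          {d : ℝ | ∃ v' : VotingGames.Game k,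
            V.Mem v' ∧ P.Domain (VotingGames.firstCoords hkn r) v' ∧
            d = VotingGames.l1dist (VotingGames.firstCoords hkn σ)
              (VotingGames.normalize (P.value (VotingGames.firstCoords hkn r) v'))} Λ ∧
        ∀ v : VotingGames.Game n, V.Mem v → P.Domain r v →
          min (2 / P.f2 k) (2 * Λ / (P.f2 k + (k : ℝ) * P.f1 k + 3)) ≤
            VotingGames.l1dist (VotingGames.normalize (P.value r v)) σ) ∧
    (∀ (n : ℕ) (_ : 3 ≤ n) (v : VotingGames.Game n), VotingGames.IsSimple v →
      (1 / 8 : ℝ) ≤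
        VotingGames.l1dist (VotingGames.normalize (VotingGames.banzhaf v))
          (fun i : Fin n =>
            if (i : ℕ) = 0 then 3 / 4 else if (i : ℕ) = 1 then 1 / 4 else 0)) := by
  open VotingGames in
  have main : ∀ (P : PowerIndex) (V : GameClass)
        (n k : ℕ) (_ : 1 < k) (hkn : k < n)
        (r : Fin n → ℕ) (_ : Function.Injective r)
        (σ : Fin n → ℝ) (_ : ∀ i, 0 ≤ σ i) (_ : ∑ i, |σ i| = 1)
        (_ : ∀ i : Fin n, k ≤ (i : ℕ) → σ i = 0),
      ∃ Λ : ℝ,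
        IsLeast
          {d : ℝ | ∃ v' : Game k, V.Mem v' ∧ P.Domain (firstCoords hkn r) v' ∧
            d = l1dist (firstCoords hkn σ) (normalize (P.value (firstCoords hkn r) v'))} Λ ∧
        ∀ v : Game n, V.Mem v → P.Domain r v →
          min (2 / P.f2 k) (2 * Λ / (P.f2 k + (k : ℝ) * P.f1 k + 3)) ≤
            l1dist (normalize (P.value r v)) σ := by
    intro P V n k hk hkn r hr σ hσ hσ1 hσ0
    obtain ⟨Λ, hΛ⟩ := exists_isLeast_l1dist (by omega : 0 < k) V P (firstCoords hkn r)
      (firstCoords hkn σ)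
    refine ⟨Λ, hΛ, fun v hV hD => ?_⟩
    have hk0 : (0 : ℝ) < k := by exact_mod_cast (by omega : 0 < k)
    have hf1 := one_le_f1 P hk
    have hf2 := add_one_le_f2 P hk
    set d := l1dist (normalize (P.value r v)) σ with hd
    -- A large `d` already exceeds `2 / P.f2 k`, since `P.f2 k ≥ k + 1`.
    rcases le_or_gt (2 / ((k : ℝ) + 1)) d with hlarge | hsmall
    · refine (min_le_left _ _).trans (le_trans ?_ hlarge)
      gcongr
    · refine (min_le_right _ _).trans ?_
      obtain ⟨x, y, v', c, hx, hx0, hxs, hy, hc, hxy, hv'⟩ := hasApproximation P hkn hr hD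
      rw [hd, hx] at hsmall
      have hσ1' : ∑ i, σ i = 1 := by
        rw [← hσ1]
        exact Finset.sum_congr rfl fun i _ => (abs_of_nonneg (hσ i)).symm
      obtain ⟨hne, hle⟩ := l1dist_normalize_le hkn hx0 hxs hy hc hσ1' hσ0 hxy hsmall
      obtain ⟨hD', hV', hnorm⟩ := hv' hne
      rw [← hnorm, ← hx, ← hd] at hle
      have hΛle := (hΛ.2 ⟨v', hV' V hV, hD', rfl⟩).trans hle
      have hd0 : 0 ≤ d := l1dist_nonneg _ _
      have hkf : (k : ℝ) * 1 ≤ k * P.f1 k := mul_le_mul_of_nonneg_left hf1 hk0.le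
      rw [div_le_iff₀ (by linarith)]
      -- `2k + 4 = (k + 1) + k * 1 + 3` is twice the factor `k + 2` in `hle`.
      have : d * (2 * k + 4) ≤ d * (P.f2 k + k * P.f1 k + 3) :=
        mul_le_mul_of_nonneg_left (by linarith) hd0
      linarith
  refine ⟨main, fun n hn v hv => ?_⟩
  have hsum : ∑ i : Fin n, (if (i : ℕ) = 0 then (3 / 4 : ℝ) else if (i : ℕ) = 1 then 1 / 4
      else 0) = 1 := by
    obtain ⟨m, rfl⟩ : ∃ m, n = m + 2 := ⟨n - 2, by omega⟩
    rw [Fin.sum_univ_succ, Fin.sum_univ_succ]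
    norm_num [Fin.val_succ]
  have hnn : ∀ i : Fin n, (0 : ℝ) ≤ if (i : ℕ) = 0 then (3 / 4 : ℝ) else
      if (i : ℕ) = 1 then 1 / 4 else 0 := by
    intro i
    split_ifs <;> norm_num
  obtain ⟨Λ, ⟨⟨v', hv', -, hΛ⟩, -⟩, hbound⟩ := main .Bz .simple n 2 (by norm_num) (by omega)
    (fun i => i) Fin.val_injective
    (fun i : Fin n => if (i : ℕ) = 0 then 3 / 4 else if (i : ℕ) = 1 then 1 / 4 else 0) hnn
    ((Finset.sum_congr rfl fun i _ => abs_of_nonneg (hnn i)).trans hsum)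
    (fun i hi => by
      rw [if_neg (by omega), if_neg (by omega)])
  have hhalf : (1 : ℝ) / 2 ≤ Λ := by
    rw [hΛ]
    exact VotingGames.half_le_l1dist_banzhaf_two hv' _ rfl rfl
  -- For `k = 2` the bound is `min (2/3) (2Λ / (3 + 2 + 3))`, and `Λ ≥ 1/2` gives `1/8`.
  refine le_trans ?_ (hbound v hv hv)
  simp only [VotingGames.PowerIndex.f1, VotingGames.PowerIndex.f2]
  refine le_min (by norm_num) ?_
  norm_num
  linarith
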